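/- Consider simply typed $\lambda$-terms over a set of constants with given types and an infinite set of variable names. A variable is a name together with a type, and a variable occurrence is bound by the nearest enclosing binder of the same variable (same name and same type). Terms are concrete named terms, so the names and types at their binders matter. Equality of terms means typed $\alpha\beta\eta$-equality. The bound variables of a term are those occurring at its binders, and they include the binders that $\eta$-expansion requires. A pattern unification problem $P$ is a finite set of equations $t\stackrel{?}{=}u$ between terms of equal type, written in $\eta$-long $\beta$-normal form, in which every free variable occurs applied to a list of terms that are equal (up to $\eta$) to pairwise distinct bound variables. Let $\mathrm{Vars}(P)$ be its set of free variables. A substitution $\sigma=[X_1\mapsto t_1,\dots,X_k\mapsto t_k]$ is finite and type preserving, has domain $\{X_1,\dots,X_k\}$, and acts without variable capture. A free variable occurs in $\sigma$ if it is free in some $t_i$. A unifier of $P$ is a substitution $\sigma$ with $\sigma(t)=\sigma(u)$ for all equations of $P$. A most general unifier of $P$ is a unifier $\sigma$ with domain $\mathrm{Vars}(P)$ such that for every unifier $\tau$ of $P$ there is a substitution $\rho$ with $\rho(\sigma(X))=\tau(X)$ for all $X\in\mathrm{Vars}(P)$. **Lemma.** Let $P$ be a solvable pattern unification problem in which no name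 of a free variable is also the name of a bound variable, and let $\langle a_1,\dots,a_n\rangle$ be a list, without repetitions, of the names of the bound variables of $P$. Then $P$ has a most general unifier $\sigma$, whose terms are written in $\eta$-long $\beta$-normal form, such that 1. every bound variable of $\sigma$ has its name in $\{a_1,\dots,a_n\}$. If, moreover, all bound variables of $P$ with the same name have the same type, say every bound variable with name $a_i$ has type $\tau_i$, then the same $\sigma$ satisfies 2. every bound variable of $\sigma$ with name $a_i$ has type $\tau_i$, and 3. every free variable occurring in $\sigma$ has a type $\nu_1\to\cdots\to\nu_m\to\nu$ with $\nu$ a basic type and $\langle\nu_1,\dots,\nu_m\rangle$ a sublist (order preserved) of $\langle\tau_1,\dots,\tau_n\rangle$. -/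

import Mathlib

namespace HOPattern

/-- Simple types over a set `B` of basic types. -/
inductive Ty (B : Type*) where
  | base (b : B) : Ty B
  | arr (a b : Ty B) : Ty B

/-- The list `ν₁, …, νₘ` of argument types of `ν₁ → ⋯ → νₘ → ν`, where `ν` is basic. -/
def Ty.args {B : Type*} : Ty B → List (Ty B)
  | .base _ => []
  | .arr a b => a :: b.args

/-- A variable: a name together with its assigned type. -/
@[ext] structure Var (N B : Type*) where
  name : N
  type : Ty B

/-- Named (concrete, not up to renaming) lambda-terms over the constants `C`. -/
inductive Tm (N B C : Type*) where
  | var (x : Var N B) : Tm N B C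
  | const (c : C) : Tm N B C
  | lam (x : Var N B) (t : Tm N B C) : Tm N B C
  | app (t u : Tm N B C) : Tm N B C

/-- Nameless lambda-terms, used as classes of named terms modulo alpha-equivalence: bound variable
occurrences are de Bruijn indices, free variables keep their names. -/
inductive ATm (N B C : Type*) where
  | bvar (i : ℕ) : ATm N B C
  | fvar (x : Var N B) : ATm N B C
  | const (c : C) : ATm N B C
  | lam (a : Ty B) (t : ATm N B C) : ATm N B C
  | app (t u : ATm N B C) : ATm N B C

namespace ATm

variable {N B C : Type*}

open Classical in
/-- Turn the free variable `x` into the index `k` (counted from the root of the term). -/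
noncomputable def abstr (x : Var N B) : ℕ → ATm N B C → ATm N B C
  | _, .bvar i => .bvar i
  | k, .fvar y => if y = x then .bvar k else .fvar y
  | _, .const c => .const c
  | k, .lam a t => .lam a (abstr x (k + 1) t)
  | k, .app t u => .app (abstr x k t) (abstr x k u)

/-- A renaming of indices, extended under a binder. -/
def upr (r : ℕ → ℕ) : ℕ → ℕ
  | 0 => 0
  | i + 1 => r i + 1

/-- Renaming of the indices. -/
def rename : (ℕ → ℕ) → ATm N B C → ATm N B C
  | r, .bvar i => .bvar (r i)
  | _, .fvar x => .fvar x
  | _, .const c => .const c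
  | r, .lam a t => .lam a (rename (upr r) t)
  | r, .app t u => .app (rename r t) (rename r u)

/-- A simultaneous replacement of indices, extended under a binder. -/
def ups (s : ℕ → ATm N B C) : ℕ → ATm N B C
  | 0 => .bvar 0
  | i + 1 => rename Nat.succ (s i)

/-- Simultaneous replacement of the indices. -/
def bsubst : (ℕ → ATm N B C) → ATm N B C → ATm N B C
  | s, .bvar i => s i
  | _, .fvar x => .fvar x
  | _, .const c => .const c
  | s, .lam a t => .lam a (bsubst (ups s) t)
  | s, .app t u => .app (bsubst s t) (bsubst s u)

/-- `inst u t` replaces index `0` of `t` by `u`: the contractum of `(λ. t) u`. -/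
def inst (u : ATm N B C) (t : ATm N B C) : ATm N B C :=
  bsubst (fun i => match i with
    | 0 => u
    | j + 1 => .bvar j) t

/-- Replacement of the free variables; used with index-closed `s x` only, so that nothing has to be
shifted under a binder. -/
def fsubst (s : Var N B → ATm N B C) : ATm N B C → ATm N B C
  | .bvar i => .bvar i
  | .fvar x => s x
  | .const c => .const c
  | .lam a t => .lam a (fsubst s t)
  | .app t u => .app (fsubst s t) (fsubst s u)

/-- Simple typing; `Γ` lists the types of the indices. -/
inductive HasType (ct : C → Ty B) : List (Ty B) → ATm N B C → Ty B → Prop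
  | bvar {Γ : List (Ty B)} {i : ℕ} {a : Ty B} : Γ[i]? = some a → HasType ct Γ (.bvar i) a
  | fvar {Γ : List (Ty B)} (x : Var N B) : HasType ct Γ (.fvar x) x.type
  | const {Γ : List (Ty B)} (c : C) : HasType ct Γ (.const c) (ct c)
  | lam {Γ : List (Ty B)} {a b : Ty B} {t : ATm N B C} :
      HasType ct (a :: Γ) t b → HasType ct Γ (.lam a t) (.arr a b)
  | app {Γ : List (Ty B)} {a b : Ty B} {t u : ATm N B C} :
      HasType ct Γ t (.arr a b) → HasType ct Γ u a → HasType ct Γ (.app t u) b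

/-- Equality of typed lambda-terms modulo beta and eta (and alpha, which is built in). -/
inductive Conv (ct : C → Ty B) : List (Ty B) → Ty B → ATm N B C → ATm N B C → Prop
  | refl {Γ : List (Ty B)} {a : Ty B} {t : ATm N B C} : HasType ct Γ t a → Conv ct Γ a t t
  | symm {Γ : List (Ty B)} {a : Ty B} {t u : ATm N B C} : Conv ct Γ a t u → Conv ct Γ a u t
  | trans {Γ : List (Ty B)} {a : Ty B} {t u v : ATm N B C} :
      Conv ct Γ a t u → Conv ct Γ a u v → Conv ct Γ a t v
  | lam {Γ : List (Ty B)} {a b : Ty B} {t u : ATm N B C} :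
      Conv ct (a :: Γ) b t u → Conv ct Γ (.arr a b) (.lam a t) (.lam a u)
  | app {Γ : List (Ty B)} {a b : Ty B} {t t' u u' : ATm N B C} :
      Conv ct Γ (.arr a b) t t' → Conv ct Γ a u u' → Conv ct Γ b (.app t u) (.app t' u')
  | beta {Γ : List (Ty B)} {a b : Ty B} {t u : ATm N B C} :
      HasType ct (a :: Γ) t b → HasType ct Γ u a →
        Conv ct Γ b (.app (.lam a t) u) (inst u t)
  | eta {Γ : List (Ty B)} {a b : Ty B} {t : ATm N B C} :
      HasType ct Γ t (.arr a b) →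
        Conv ct Γ (.arr a b) (.lam a (.app (rename Nat.succ t) (.bvar 0))) t

end ATm

namespace Tm

variable {N B C : Type*}

/-- The class of a named term modulo alpha-equivalence: `λ x. t` binds the free `x` of `t`. -/
noncomputable def toATm : Tm N B C → ATm N B C
  | .var x => .fvar x
  | .const c => .const c
  | .lam x t => .lam x.type (ATm.abstr x 0 t.toATm)
  | .app t u => .app t.toATm u.toATm

/-- Simple typing of named terms (every variable carries its type). -/
inductive HasType (ct : C → Ty B) : Tm N B C → Ty B → Prop
  | var (x : Var N B) : HasType ct (.var x) x.type
  | const (c : C) : HasType ct (.const c) (ct c)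
  | lam {x : Var N B} {b : Ty B} {t : Tm N B C} :
      HasType ct t b → HasType ct (.lam x t) (.arr x.type b)
  | app {a b : Ty B} {t u : Tm N B C} :
      HasType ct t (.arr a b) → HasType ct u a → HasType ct (.app t u) b

/-- The free variables. -/
def fv : Tm N B C → Set (Var N B)
  | .var x => {x}
  | .const _ => ∅
  | .lam x t => t.fv \ {x}
  | .app t u => t.fv ∪ u.fv

/-- The bound variables: those occurring at a binder. -/
def bv : Tm N B C → Set (Var N B)
  | .var _ => ∅
  | .const _ => ∅
  | .lam x t => insert x t.bv
  | .app t u => t.bv ∪ u.bv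

/-- `h(t₁, …, tₘ)`. -/
def apps (h : Tm N B C) (ts : List (Tm N B C)) : Tm N B C := ts.foldl .app h

mutual

/-- `Long ct t a`: `t` is a term of type `a` in eta-long beta-normal form, i.e. of the form
`λ x₁ … xₙ. h(t₁, …, tₘ)` with `h` a variable or a constant, `h(t₁, …, tₘ)` of basic type, and all
`tᵢ` again of this form. -/
inductive Long (ct : C → Ty B) : Tm N B C → Ty B → Prop
  | lam {x : Var N B} {b : Ty B} {t : Tm N B C} :
      Long ct t b → Long ct (.lam x t) (.arr x.type b)
  | spine {t : Tm N B C} {b : B} : Spine ct t (.base b) → Long ct t (.base b)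

/-- `Spine ct t a`: `t = h(t₁, …, tₘ)` has type `a`, with `h` a variable or a constant and all `tᵢ`
in eta-long beta-normal form. -/
inductive Spine (ct : C → Ty B) : Tm N B C → Ty B → Prop
  | var (x : Var N B) : Spine ct (.var x) x.type
  | const (c : C) : Spine ct (.const c) (ct c)
  | app {a b : Ty B} {t u : Tm N B C} :
      Spine ct t (.arr a b) → Long ct u a → Spine ct (.app t u) b

end

/-- `t` equals the variable `x` (modulo alpha, beta, eta); for `t` in eta-long beta-normal form:
`t` is the eta-long form of `x`. -/
def IsVar (ct : C → Ty B) (t : Tm N B C) (x : Var N B) : Prop :=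
  ATm.Conv ct [] x.type t.toATm (.fvar x)

/-- Pattern condition on a term in eta-long beta-normal form, `V` being the variables bound above
it: every free variable is applied to pairwise distinct bound variables. -/
inductive IsPattern (ct : C → Ty B) : Set (Var N B) → Tm N B C → Prop
  | lam {V : Set (Var N B)} {x : Var N B} {t : Tm N B C} :
      IsPattern ct (insert x V) t → IsPattern ct V (.lam x t)
  | const {V : Set (Var N B)} (c : C) {ts : List (Tm N B C)} :
      (∀ t ∈ ts, IsPattern ct V t) → IsPattern ct V (apps (.const c) ts)
  | bound {V : Set (Var N B)} {x : Var N B} {ts : List (Tm N B C)} :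
      x ∈ V → (∀ t ∈ ts, IsPattern ct V t) → IsPattern ct V (apps (.var x) ts)
  | free {V : Set (Var N B)} {X : Var N B} {ts : List (Tm N B C)} {xs : List (Var N B)} :
      X ∉ V → xs.Nodup → (∀ x ∈ xs, x ∈ V) → List.Forall₂ (IsVar ct) ts xs →
        IsPattern ct V (apps (.var X) ts)

end Tm

/-- A unification problem: a finite set of equations (pairs of named terms). -/
abbrev Problem (N B C : Type*) := Finset (Tm N B C × Tm N B C)

namespace Problem

variable {N B C : Type*}

/-- Both sides of every equation are higher-order patterns of the same type, written in eta-long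
beta-normal form. -/
def IsPatternProblem (ct : C → Ty B) (P : Problem N B C) : Prop :=
  ∀ e ∈ P, (∃ a : Ty B, Tm.Long ct e.1 a ∧ Tm.Long ct e.2 a) ∧
    Tm.IsPattern ct ∅ e.1 ∧ Tm.IsPattern ct ∅ e.2

/-- The free variables of the problem. -/
def vars (P : Problem N B C) : Set (Var N B) := {X | ∃ e ∈ P, X ∈ e.1.fv ∨ X ∈ e.2.fv}

/-- The bound variables of the problem. -/
def boundVars (P : Problem N B C) : Set (Var N B) := {x | ∃ e ∈ P, x ∈ e.1.bv ∨ x ∈ e.2.bv}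

end Problem

/-- A substitution `[X₁ ↦ t₁, …, Xₙ ↦ tₙ]`, with domain `{X₁, …, Xₙ}` and `tᵢ` of the type of `Xᵢ`.
The values of `val` outside `dom` are irrelevant. -/
structure Subst (N B : Type*) {C : Type*} (ct : C → Ty B) where
  dom : Finset (Var N B)
  val : Var N B → Tm N B C
  typed : ∀ X ∈ dom, Tm.HasType ct (val X) X.type

namespace Subst

variable {N B C : Type*} {ct : C → Ty B}

open Classical in
/-- `σ(X)`, modulo alpha. -/
noncomputable def image (σ : Subst N B ct) (X : Var N B) : ATm N B C :=
  if X ∈ σ.dom then (σ.val X).toATm else .fvar X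

/-- `σ(t)`, modulo alpha (capture-avoiding). -/
noncomputable def apply (σ : Subst N B ct) (t : ATm N B C) : ATm N B C :=
  ATm.fsubst σ.image t

/-- `σ` solves `P`: `σ(t)` and `σ(u)` are equal modulo alpha, beta, eta for all equations. -/
def IsUnifier (σ : Subst N B ct) (P : Problem N B C) : Prop :=
  ∀ e ∈ P, ∃ a : Ty B, ATm.Conv ct [] a (σ.apply e.1.toATm) (σ.apply e.2.toATm)

/-- `σ` is more general than `τ` on `V`: some `ρ` satisfies `ρ(σ(X)) = τ(X)` for all `X ∈ V`. -/
def MoreGeneralOn (V : Set (Var N B)) (σ τ : Subst N B ct) : Prop :=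
  ∃ ρ : Subst N B ct, ∀ X ∈ V, ATm.Conv ct [] X.type (ρ.apply (σ.image X)) (τ.image X)

/-- `σ` is a most general unifier of `P`: a unifier with domain `vars P` that is more general (on
`vars P`) than every unifier of `P`. -/
def IsMostGeneral (σ : Subst N B ct) (P : Problem N B C) : Prop :=
  σ.IsUnifier P ∧ (σ.dom : Set (Var N B)) = P.vars ∧
    ∀ τ : Subst N B ct, τ.IsUnifier P → MoreGeneralOn P.vars σ τ

/-- The terms of `σ` are written in eta-long beta-normal form. -/
def IsLong (σ : Subst N B ct) : Prop := ∀ X ∈ σ.dom, Tm.Long ct (σ.val X) X.type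

/-- The bound variables of `σ`. -/
def boundVars (σ : Subst N B ct) : Set (Var N B) := {x | ∃ X ∈ σ.dom, x ∈ (σ.val X).bv}

/-- The free variables occurring in `σ`, i.e. in some `σ(X)` with `X` in the domain. -/
def freeVars (σ : Subst N B ct) : Set (Var N B) := {Z | ∃ X ∈ σ.dom, Z ∈ (σ.val X).fv}

end Subst

end HOPattern

-- The most general unifier is the least general generalization of all unifiers at once. Let `V` be
-- the set of bound variables of the problem and `Q` the set of its free variables. After renaming,
-- a unifier introduces no variable of `V` (`Subst.IsUnifier.exists_closedSubst`). Let `I` index all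
-- such unifiers. Each pattern `t` over `V` and `Q` then has a family of values, indexed by `I`: the
-- eta-long normal forms of its instances.
--
-- The family of `λ x. t` consists of abstractions over the same `x`. A rigid pattern gives a family
-- with a common head, whose arguments are again families of patterns. The family of a flexible
-- pattern may coincide with that of a rigid pattern, and it is then decomposed in the same way.
-- Otherwise it becomes a leaf: a fresh variable applied to eta-long forms of those variables of `V`
-- that occur in the family. This is the relation `Gen`. Decomposition terminates because the size
-- of one fixed member decreases (`exists_gen`). All binders come from patterns over `V` or from
-- such eta-long forms, so they lie in `V`.
--
-- Two occurrences of one `X` have distinct arguments from `V` and hence differ by a type preserving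
-- permutation of `V`. Fresh variables are therefore attached to families modulo these permutations,
-- and there are only finitely many of them (`flexClasses_finite`). The arguments of a fresh
-- variable follow a fixed enumeration of `V`, which yields the sublist property of its type.
--
-- The generalization depends only on the family (`Gen.toATm_eq`), and mapping each `X` to the
-- abstracted generalization of one of its occurrences sends every pattern to its own generalization
-- (`Tm.Pat.exists_gen_conv`). Both sides of an equation have the same family, so this substitution
-- is a unifier. Replacing each fresh variable by the `i`-th member of its class, abstracted over
-- its support, recovers the `i`-th unifier (`IsGenOf.conv_instantiation`), so it is most general.
--
-- The argument needs canonical normal forms. Existence is Tait's reducibility argument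
-- (`exists_long`); uniqueness up to alpha is normalization by evaluation in the full type structure
-- (`Long.toATm_eq`).

namespace HOPattern

variable {N B C : Type*}

-- Substitution, abstraction, typing and conversion of nameless terms.

namespace ATm

/-- The free variables. -/
def afv : ATm N B C → Set (Var N B)
  | .bvar _ => ∅
  | .fvar x => {x}
  | .const _ => ∅
  | .lam _ t => t.afv
  | .app t u => t.afv ∪ u.afv

/-- All indices are less than `k` (counted from the root). -/
def Closed : ℕ → ATm N B C → Prop
  | k, .bvar i => i < k
  | _, .fvar _ => True
  | _, .const _ => True
  | k, .lam _ t => Closed (k + 1) t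
  | k, .app t u => Closed k t ∧ Closed k u

open Classical in
/-- `upd s x u` maps `x` to `u` and is `s` elsewhere. -/
noncomputable def upd (s : Var N B → ATm N B C) (x : Var N B) (u : ATm N B C) :
    Var N B → ATm N B C := fun y => if y = x then u else s y

@[simp] theorem upd_self (s : Var N B → ATm N B C) (x : Var N B) (u : ATm N B C) :
    upd s x u x = u := by simp [upd]

theorem upd_of_ne (s : Var N B → ATm N B C) {x y : Var N B} (u : ATm N B C) (h : y ≠ x) :
    upd s x u y = s y := by simp [upd, h]

theorem afv_finite (t : ATm N B C) : t.afv.Finite := by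
  induction t with
  | bvar i => exact Set.finite_empty
  | fvar x => exact Set.finite_singleton x
  | const c => exact Set.finite_empty
  | lam a t ih => exact ih
  | app t u ih₁ ih₂ => exact ih₁.union ih₂

theorem fsubst_fvar (t : ATm N B C) : fsubst .fvar t = t := by
  induction t <;> simp_all [fsubst]

theorem fsubst_fsubst (s r : Var N B → ATm N B C) (t : ATm N B C) :
    fsubst s (fsubst r t) = fsubst (fun x => fsubst s (r x)) t := by
  induction t <;> simp_all [fsubst]

theorem fsubst_congr {s r : Var N B → ATm N B C} {t : ATm N B C}
    (h : ∀ x ∈ t.afv, s x = r x) : fsubst s t = fsubst r t := by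
  induction t with
  | bvar i => rfl
  | fvar x => exact h x rfl
  | const c => rfl
  | lam a t ih => simp only [fsubst]; rw [ih h]
  | app t u ih₁ ih₂ =>
    simp only [fsubst]
    rw [ih₁ fun x hx => h x (Or.inl hx), ih₂ fun x hx => h x (Or.inr hx)]

theorem fsubst_eq_self {s : Var N B → ATm N B C} {t : ATm N B C}
    (h : ∀ x ∈ t.afv, s x = .fvar x) : fsubst s t = t := by
  rw [fsubst_congr h, fsubst_fvar]

theorem mem_afv_fsubst {s : Var N B → ATm N B C} {t : ATm N B C} {y : Var N B} :
    y ∈ (fsubst s t).afv ↔ ∃ x ∈ t.afv, y ∈ (s x).afv := by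
  induction t with
  | bvar i => simp [fsubst, afv]
  | fvar x => simp [fsubst, afv]
  | const c => simp [fsubst, afv]
  | lam a t ih => simpa [fsubst, afv] using ih
  | app t u ih₁ ih₂ =>
    simp only [fsubst, afv, Set.mem_union, ih₁, ih₂]
    grind

theorem rename_of_closed {t : ATm N B C} {k : ℕ} {r : ℕ → ℕ} (h : Closed k t)
    (hr : ∀ i < k, r i = i) : rename r t = t := by
  induction t generalizing k r with
  | bvar i => simp only [rename]; rw [hr i h]
  | fvar x => rfl
  | const c => rfl
  | lam a t ih =>
    simp only [rename]
    rw [ih (k := k + 1) h]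
    rintro (_ | i) hi
    · rfl
    · simp only [upr]; rw [hr i (by omega)]
  | app t u ih₁ ih₂ => simp only [rename]; rw [ih₁ h.1 hr, ih₂ h.2 hr]

theorem bsubst_of_closed {t : ATm N B C} {k : ℕ} {r : ℕ → ATm N B C} (h : Closed k t)
    (hr : ∀ i < k, r i = .bvar i) : bsubst r t = t := by
  induction t generalizing k r with
  | bvar i => exact hr i h
  | fvar x => rfl
  | const c => rfl
  | lam a t ih =>
    simp only [bsubst]
    rw [ih (k := k + 1) h]
    rintro (_ | i) hi
    · rfl
    · simp only [ups]; rw [hr i (by omega)]; rfl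
  | app t u ih₁ ih₂ => simp only [bsubst]; rw [ih₁ h.1 hr, ih₂ h.2 hr]

theorem rename_closed {t : ATm N B C} {r : ℕ → ℕ} (h : Closed 0 t) : rename r t = t :=
  rename_of_closed h (by simp)

theorem bsubst_closed {t : ATm N B C} {r : ℕ → ATm N B C} (h : Closed 0 t) : bsubst r t = t :=
  bsubst_of_closed h (by simp)

theorem rename_fsubst {s : Var N B → ATm N B C} (hs : ∀ x, Closed 0 (s x)) (t : ATm N B C)
    (r : ℕ → ℕ) : rename r (fsubst s t) = fsubst s (rename r t) := by
  induction t generalizing r with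
  | fvar x => exact rename_closed (hs x)
  | _ => simp_all [rename, fsubst]

theorem bsubst_fsubst {s : Var N B → ATm N B C} (hs : ∀ x, Closed 0 (s x)) (t : ATm N B C)
    (r r' : ℕ → ATm N B C) (hr : ∀ i, r' i = fsubst s (r i)) :
    bsubst r' (fsubst s t) = fsubst s (bsubst r t) := by
  induction t generalizing r r' with
  | bvar i => exact hr i
  | fvar x => exact bsubst_closed (hs x)
  | const c => rfl
  | lam a t ih =>
    simp only [bsubst, fsubst]
    rw [ih (ups r) (ups r')]
    rintro (_ | i)
    · rfl
    · simp only [ups]; rw [hr i, rename_fsubst hs]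
  | app t u ih₁ ih₂ => simp only [bsubst, fsubst]; rw [ih₁ _ _ hr, ih₂ _ _ hr]

theorem inst_fsubst {s : Var N B → ATm N B C} (hs : ∀ x, Closed 0 (s x)) (u t : ATm N B C) :
    inst (fsubst s u) (fsubst s t) = fsubst s (inst u t) := by
  unfold inst
  apply bsubst_fsubst hs
  rintro (_ | i) <;> rfl

/-- This is beta reduction with a named binder: filling the index made from `x` amounts to updating
the substitution at `x`. The general level `k` is what the induction meets under binders. -/
theorem bsubst_fsubst_abstr {s : Var N B → ATm N B C} (hs : ∀ x, Closed 0 (s x)) {x : Var N B}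
    {u : ATm N B C} (hu : Closed 0 u) {k : ℕ} {t : ATm N B C} (ht : Closed k t)
    {r : ℕ → ATm N B C} (hr : ∀ i < k, r i = .bvar i) (hk : r k = u) :
    bsubst r (fsubst s (abstr x k t)) = fsubst (upd s x u) t := by
  induction t generalizing k r with
  | bvar i => exact hr i ht
  | fvar y =>
    by_cases h : y = x
    · subst h; simp [abstr, fsubst, bsubst, hk]
    · simp only [abstr, fsubst, h, if_false, upd]
      exact bsubst_closed (hs y)
  | const c => rfl
  | lam a t ih =>
    simp only [bsubst, fsubst, abstr]
    rw [ih (k := k + 1) ht]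
    · rintro (_ | i) hi
      · rfl
      · simp only [ups]; rw [hr i (by omega)]; rfl
    · simp only [ups]; rw [hk, rename_closed hu]
  | app t u ih₁ ih₂ =>
    simp only [bsubst, fsubst, abstr]; rw [ih₁ ht.1 hr hk, ih₂ ht.2 hr hk]

theorem inst_fsubst_abstr {s : Var N B → ATm N B C} (hs : ∀ x, Closed 0 (s x)) {x : Var N B}
    {u t : ATm N B C} (hu : Closed 0 u) (ht : Closed 0 t) :
    inst u (fsubst s (abstr x 0 t)) = fsubst (upd s x u) t :=
  bsubst_fsubst_abstr hs hu ht (by simp) rfl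

theorem afv_abstr (x : Var N B) (k : ℕ) (t : ATm N B C) : (abstr x k t).afv = t.afv \ {x} := by
  induction t generalizing k with
  | bvar i => simp [abstr, afv]
  | fvar y =>
    by_cases h : y = x
    · simp [abstr, afv, h]
    · simp only [abstr, afv, h, if_false]
      ext z; simp; rintro rfl; exact h
  | const c => simp [abstr, afv]
  | lam a t ih => simpa [abstr, afv] using ih _
  | app t u ih₁ ih₂ => simp [abstr, afv, ih₁, ih₂, Set.union_sdiff_distrib]

theorem abstr_of_notMem {x : Var N B} {t : ATm N B C} (k : ℕ) (h : x ∉ t.afv) :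
    abstr x k t = t := by
  induction t generalizing k with
  | bvar i => rfl
  | fvar y => simp only [abstr]; rw [if_neg]; rintro rfl; exact h rfl
  | const c => rfl
  | lam a t ih => simp only [abstr]; rw [ih _ h]
  | app t u ih₁ ih₂ =>
    simp only [abstr]; rw [ih₁ _ fun h' => h (Or.inl h'), ih₂ _ fun h' => h (Or.inr h')]

/-- The hypothesis is the condition of capture avoidance: a binder `x` may be renamed to `y` if no
substituted value that stays free in the body mentions `y`. -/
theorem fsubst_abstr {s : Var N B → ATm N B C} {x y : Var N B} {t : ATm N B C} (k : ℕ)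
    (h : ∀ z ∈ t.afv, z ≠ x → y ∉ (s z).afv) :
    fsubst s (abstr x k t) = abstr y k (fsubst (upd s x (.fvar y)) t) := by
  induction t generalizing k with
  | bvar i => rfl
  | fvar z =>
    by_cases hz : z = x
    · subst hz; simp [abstr, fsubst]
    · simp only [abstr, fsubst, hz, if_false, upd]
      exact (abstr_of_notMem k (h z rfl hz)).symm
  | const c => rfl
  | lam a t ih => simp only [abstr, fsubst]; rw [ih _ h]
  | app t u ih₁ ih₂ =>
    simp only [abstr, fsubst]
    rw [ih₁ _ fun z hz => h z (Or.inl hz), ih₂ _ fun z hz => h z (Or.inr hz)]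

theorem fsubst_abstr_self {s : Var N B → ATm N B C} {x y : Var N B} {t : ATm N B C} (k : ℕ)
    (h : ∀ z ∈ t.afv, z ≠ x → y ∉ (s z).afv) (hx : s x = .fvar y) :
    fsubst s (abstr x k t) = abstr y k (fsubst s t) := by
  rw [fsubst_abstr k h]
  congr 2
  funext z
  by_cases hz : z = x
  · subst hz; simp [hx]
  · simp [upd, hz]

theorem rename_abstr (x : Var N B) (t : ATm N B C) (r : ℕ → ℕ) (k : ℕ) :
    rename r (abstr x k t) = abstr x (r k) (rename r t) := by
  induction t generalizing r k with
  | bvar i => rfl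
  | fvar y => simp only [abstr, rename]; split <;> rfl
  | const c => rfl
  | lam a t ih => simp only [abstr, rename]; rw [ih]; rfl
  | app t u ih₁ ih₂ => simp only [abstr, rename]; rw [ih₁, ih₂]

theorem bsubst_abstr (x : Var N B) (t : ATm N B C) {r r' : ℕ → ATm N B C} {k k' : ℕ}
    (hr : ∀ i, r' i = abstr x k' (r i)) (hk : r' k = .bvar k') :
    bsubst r' (abstr x k t) = abstr x k' (bsubst r t) := by
  induction t generalizing r r' k k' with
  | bvar i => exact hr i
  | fvar y =>
    simp only [abstr, bsubst]; split
    · exact hk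
    · rfl
  | const c => rfl
  | lam a t ih =>
    simp only [abstr, bsubst]
    rw [ih (r := ups r) (r' := ups r') (k' := k' + 1)]
    · rintro (_ | i)
      · rfl
      · simp only [ups]; rw [hr i, rename_abstr]
    · simp only [ups]; rw [hk]; rfl
  | app t u ih₁ ih₂ => simp only [abstr, bsubst]; rw [ih₁ hr hk, ih₂ hr hk]

theorem inst_abstr (x : Var N B) (t u : ATm N B C) (k : ℕ) :
    inst (abstr x k u) (abstr x (k + 1) t) = abstr x k (inst u t) := by
  unfold inst
  apply bsubst_abstr
  · rintro (_ | i) <;> rfl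
  · rfl

/-! ### Typing -/

variable {ct : C → Ty B}

theorem HasType.closed {Γ : List (Ty B)} {t : ATm N B C} {a : Ty B} (h : HasType ct Γ t a) :
    Closed Γ.length t := by
  induction h with
  | bvar h => exact (List.getElem?_eq_some_iff.1 h).1
  | fvar x => trivial
  | const c => trivial
  | lam _ ih => exact ih
  | app _ _ ih₁ ih₂ => exact ⟨ih₁, ih₂⟩

theorem HasType.unique {Γ : List (Ty B)} {t : ATm N B C} {a b : Ty B} (h : HasType ct Γ t a)
    (h' : HasType ct Γ t b) : a = b := by
  induction h generalizing b with
  | bvar h => cases h' with | bvar h' => rw [h] at h'; exact Option.some.inj h'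
  | fvar x => cases h'; rfl
  | const c => cases h'; rfl
  | lam _ ih => cases h' with | lam h' => rw [ih h']
  | app _ _ ih₁ ih₂ =>
    cases h' with | app h₁ h₂ => have := ih₁ h₁; injection this

theorem HasType.append {Γ : List (Ty B)} {t : ATm N B C} {a : Ty B} (Δ : List (Ty B))
    (h : HasType ct Γ t a) : HasType ct (Γ ++ Δ) t a := by
  induction h with
  | bvar h =>
    have := (List.getElem?_eq_some_iff.1 h).1
    exact .bvar (by rw [List.getElem?_append_left this, h])
  | fvar x => exact .fvar x
  | const c => exact .const c
  | lam _ ih => exact .lam ih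
  | app _ _ ih₁ ih₂ => exact .app ih₁ ih₂

theorem HasType.weaken {t : ATm N B C} {a : Ty B} (Δ : List (Ty B))
    (h : HasType ct [] t a) : HasType ct Δ t a := h.append Δ

theorem HasType.rename {Γ Δ : List (Ty B)} {t : ATm N B C} {a : Ty B} {r : ℕ → ℕ}
    (h : HasType ct Γ t a) (hr : ∀ i b, Γ[i]? = some b → Δ[r i]? = some b) :
    HasType ct Δ (rename r t) a := by
  induction h generalizing Δ r with
  | bvar h => exact .bvar (hr _ _ h)
  | fvar x => exact .fvar x
  | const c => exact .const c
  | lam _ ih =>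
    refine .lam (ih ?_)
    rintro (_ | i) b hb
    · exact hb
    · exact hr i b hb
  | app _ _ ih₁ ih₂ => exact .app (ih₁ hr) (ih₂ hr)

theorem HasType.bsubst {Γ Δ : List (Ty B)} {t : ATm N B C} {a : Ty B} {r : ℕ → ATm N B C}
    (h : HasType ct Γ t a) (hr : ∀ i b, Γ[i]? = some b → HasType ct Δ (r i) b) :
    HasType ct Δ (bsubst r t) a := by
  induction h generalizing Δ r with
  | bvar h => exact hr _ _ h
  | fvar x => exact .fvar x
  | const c => exact .const c
  | lam _ ih =>
    refine .lam (ih ?_)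
    rintro (_ | i) b hb
    · exact .bvar hb
    · exact (hr i b hb).rename fun _ _ h => h
  | app _ _ ih₁ ih₂ => exact .app (ih₁ hr) (ih₂ hr)

theorem HasType.inst {Γ : List (Ty B)} {t u : ATm N B C} {a b : Ty B}
    (h : HasType ct (a :: Γ) t b) (hu : HasType ct Γ u a) : HasType ct Γ (inst u t) b := by
  refine h.bsubst ?_
  rintro (_ | i) c hc
  · obtain rfl : a = c := by simpa using hc
    exact hu
  · exact .bvar hc

theorem HasType.fsubst {s : Var N B → ATm N B C} (hs : ∀ x, HasType ct [] (s x) x.type)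
    {Γ : List (Ty B)} {t : ATm N B C} {a : Ty B} (h : HasType ct Γ t a) :
    HasType ct Γ (fsubst s t) a := by
  induction h with
  | bvar h => exact .bvar h
  | fvar x => exact (hs x).weaken _
  | const c => exact .const c
  | lam _ ih => exact .lam ih
  | app _ _ ih₁ ih₂ => exact .app ih₁ ih₂

/-- Levels are counted from the root, so the abstracted variable becomes the outermost index and its
type enters at the far end of the context. -/
theorem HasType.abstr (x : Var N B) {Γ : List (Ty B)} {t : ATm N B C} {a : Ty B}
    (h : HasType ct Γ t a) : HasType ct (Γ ++ [x.type]) (abstr x Γ.length t) a := by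
  induction h with
  | bvar h =>
    have := (List.getElem?_eq_some_iff.1 h).1
    exact .bvar (by rw [List.getElem?_append_left this, h])
  | fvar y =>
    simp only [ATm.abstr]; split
    · rename_i h; subst h; exact .bvar (by simp)
    · exact .fvar y
  | const c => exact .const c
  | lam _ ih => exact .lam ih
  | app _ _ ih₁ ih₂ => exact .app ih₁ ih₂

theorem HasType.lam_abstr {x : Var N B} {t : ATm N B C} {a : Ty B}
    (h : HasType ct [] t a) : HasType ct [] (.lam x.type (ATm.abstr x 0 t)) (.arr x.type a) :=
  .lam (h.abstr x)

theorem closed_of_hasType {s : Var N B → ATm N B C} (hs : ∀ x, HasType ct [] (s x) x.type)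
    (x : Var N B) : Closed 0 (s x) := (hs x).closed

theorem HasType.upd {s : Var N B → ATm N B C} (hs : ∀ x, HasType ct [] (s x) x.type)
    {x : Var N B} {u : ATm N B C} (hu : HasType ct [] u x.type) (y : Var N B) :
    HasType ct [] (ATm.upd s x u y) y.type := by
  unfold ATm.upd; split
  · rename_i h; subst h; exact hu
  · exact hs y

/-! ### Conversion -/

theorem Conv.hasType {Γ : List (Ty B)} {a : Ty B} {t u : ATm N B C} (h : Conv ct Γ a t u) :
    HasType ct Γ t a ∧ HasType ct Γ u a := by
  induction h with
  | refl h => exact ⟨h, h⟩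
  | symm _ ih => exact ⟨ih.2, ih.1⟩
  | trans _ _ ih₁ ih₂ => exact ⟨ih₁.1, ih₂.2⟩
  | lam _ ih => exact ⟨.lam ih.1, .lam ih.2⟩
  | app _ _ ih₁ ih₂ => exact ⟨.app ih₁.1 ih₂.1, .app ih₁.2 ih₂.2⟩
  | beta h₁ h₂ => exact ⟨.app (.lam h₁) h₂, h₁.inst h₂⟩
  | eta h => exact ⟨.lam (.app (h.rename fun _ _ h => h) (.bvar rfl)), h⟩

theorem Conv.append {Γ : List (Ty B)} {a : Ty B} {t u : ATm N B C} (Δ : List (Ty B))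
    (h : Conv ct Γ a t u) : Conv ct (Γ ++ Δ) a t u := by
  induction h with
  | refl h => exact .refl (h.append Δ)
  | symm _ ih => exact ih.symm
  | trans _ _ ih₁ ih₂ => exact ih₁.trans ih₂
  | lam _ ih => exact .lam ih
  | app _ _ ih₁ ih₂ => exact .app ih₁ ih₂
  | beta h₁ h₂ => exact .beta (h₁.append Δ) (h₂.append Δ)
  | eta h => exact .eta (h.append Δ)

theorem Conv.fsubst {s : Var N B → ATm N B C} (hs : ∀ x, HasType ct [] (s x) x.type)
    {Γ : List (Ty B)} {a : Ty B} {t u : ATm N B C} (h : Conv ct Γ a t u) :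
    Conv ct Γ a (fsubst s t) (fsubst s u) := by
  induction h with
  | refl h => exact .refl (h.fsubst hs)
  | symm _ ih => exact ih.symm
  | trans _ _ ih₁ ih₂ => exact ih₁.trans ih₂
  | lam _ ih => exact .lam ih
  | app _ _ ih₁ ih₂ => exact .app ih₁ ih₂
  | beta h₁ h₂ =>
    rw [← inst_fsubst (closed_of_hasType hs)]
    exact .beta (h₁.fsubst hs) (h₂.fsubst hs)
  | eta h =>
    simp only [ATm.fsubst]
    rw [← rename_fsubst (closed_of_hasType hs)]
    exact .eta (h.fsubst hs)

theorem Conv.abstr (x : Var N B) {Γ : List (Ty B)} {a : Ty B} {t u : ATm N B C}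
    (h : Conv ct Γ a t u) :
    Conv ct (Γ ++ [x.type]) a (abstr x Γ.length t) (abstr x Γ.length u) := by
  induction h with
  | refl h => exact .refl (h.abstr x)
  | symm _ ih => exact ih.symm
  | trans _ _ ih₁ ih₂ => exact ih₁.trans ih₂
  | lam _ ih => exact .lam ih
  | app _ _ ih₁ ih₂ => exact .app ih₁ ih₂
  | beta h₁ h₂ =>
    rw [← inst_abstr]
    exact .beta (h₁.abstr x) (h₂.abstr x)
  | eta h =>
    simp only [ATm.abstr]
    rw [show ∀ (k : ℕ) (t : ATm N B C), ATm.abstr x (k + 1) (rename Nat.succ t) =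
      rename Nat.succ (ATm.abstr x k t) from fun k t => (rename_abstr x t _ k).symm]
    exact .eta (h.abstr x)

theorem Conv.lam_abstr (x : Var N B) {a : Ty B} {t u : ATm N B C} (h : Conv ct [] a t u) :
    Conv ct [] (.arr x.type a) (.lam x.type (ATm.abstr x 0 t)) (.lam x.type (ATm.abstr x 0 u)) :=
  .lam (h.abstr x)

theorem Conv.eta_abstr {x : Var N B} {a : Ty B} {t : ATm N B C}
    (h : HasType ct [] t (.arr x.type a)) (hx : x ∉ t.afv) :
    Conv ct [] (.arr x.type a) (.lam x.type (ATm.abstr x 0 (.app t (.fvar x)))) t := by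
  have := Conv.eta h
  simp only [ATm.abstr, abstr_of_notMem 0 hx, if_true]
  rwa [rename_closed h.closed] at this

theorem Conv.fsubst_congr {s r : Var N B → ATm N B C} {Γ : List (Ty B)} {t : ATm N B C} {a : Ty B}
    (h : HasType ct Γ t a) (hs : ∀ x ∈ t.afv, Conv ct [] x.type (s x) (r x)) :
    Conv ct Γ a (ATm.fsubst s t) (ATm.fsubst r t) := by
  induction h with
  | bvar h => exact .refl (.bvar h)
  | fvar x => exact (hs x rfl).append _
  | const c => exact .refl (.const c)
  | lam _ ih => exact .lam (ih hs)
  | app _ _ ih₁ ih₂ =>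
    exact .app (ih₁ fun x hx => hs x (Or.inl hx)) (ih₂ fun x hx => hs x (Or.inr hx))

theorem Conv.beta_fsubst {s : Var N B → ATm N B C} (hs : ∀ x, HasType ct [] (s x) x.type)
    {x : Var N B} {t u : ATm N B C} {a : Ty B} (ht : HasType ct [] t a)
    (hu : HasType ct [] u x.type) :
    Conv ct [] a (.app (ATm.fsubst s (.lam x.type (ATm.abstr x 0 t))) u)
      (ATm.fsubst (ATm.upd s x u) t) := by
  rw [← inst_fsubst_abstr (closed_of_hasType hs) hu.closed ht.closed]
  exact .beta ((ht.abstr x).fsubst hs) hu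

end ATm

-- Named terms and their alpha-classes.

namespace Tm

variable {ct : C → Ty B}

theorem afv_toATm (t : Tm N B C) : t.toATm.afv = t.fv := by
  induction t with
  | var x => rfl
  | const c => rfl
  | lam x t ih => simp [toATm, ATm.afv, fv, ATm.afv_abstr, ih]
  | app t u ih₁ ih₂ => simp [toATm, ATm.afv, fv, ih₁, ih₂]

theorem HasType.toATm {t : Tm N B C} {a : Ty B} (h : HasType ct t a) :
    ATm.HasType ct [] t.toATm a := by
  induction h with
  | var x => exact .fvar x
  | const c => exact .const c
  | lam _ ih => exact ih.lam_abstr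
  | app _ _ ih₁ ih₂ => exact .app ih₁ ih₂

theorem fv_finite (t : Tm N B C) : t.fv.Finite := by
  rw [← afv_toATm]; exact t.toATm.afv_finite

theorem bv_finite (t : Tm N B C) : t.bv.Finite := by
  induction t with
  | var x => exact Set.finite_empty
  | const c => exact Set.finite_empty
  | lam x t ih => exact ih.insert x
  | app t u ih₁ ih₂ => exact ih₁.union ih₂

end Tm

end HOPattern

-- Existence of eta-long beta-normal forms.

namespace HOPattern

variable {N B C : Type*}

theorem exists_fresh [Infinite N] (a : Ty B) {S : Set (Var N B)} (hS : S.Finite) :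
    ∃ x : Var N B, x.type = a ∧ x ∉ S := by
  obtain ⟨n, hn⟩ := (hS.image Var.name).infinite_compl.nonempty
  exact ⟨⟨n, a⟩, rfl, fun h => hn ⟨_, h, rfl⟩⟩

namespace ATm

variable {ct : C → Ty B}

/-- The number of nodes. -/
def size : ATm N B C → ℕ
  | .bvar _ => 1
  | .fvar _ => 1
  | .const _ => 1
  | .lam _ t => t.size + 1
  | .app t u => t.size + u.size + 1

theorem size_abstr (x : Var N B) (k : ℕ) (t : ATm N B C) : (abstr x k t).size = t.size := by
  induction t generalizing k with
  | fvar y => simp only [abstr]; split <;> rfl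
  | _ => simp_all [abstr, size]

/-- Opening a binder with a variable that does not occur in the body and closing it again changes
nothing. -/
theorem abstr_bsubst {x : Var N B} {t : ATm N B C} {k : ℕ} {r : ℕ → ATm N B C}
    (ht : Closed (k + 1) t) (hx : x ∉ t.afv) (hr : ∀ i < k, r i = .bvar i) (hk : r k = .fvar x) :
    abstr x k (bsubst r t) = t := by
  induction t generalizing k r with
  | bvar i =>
    rcases Nat.lt_succ_iff_lt_or_eq.1 (show i < k + 1 from ht) with h | rfl
    · simp only [bsubst]; rw [hr i h]; rfl
    · simp only [bsubst]; rw [hk]; simp [abstr]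
  | fvar y => exact abstr_of_notMem k hx
  | const c => rfl
  | lam a t ih =>
    simp only [bsubst, abstr]
    rw [ih (k := k + 1) ht hx]
    · rintro (_ | i) hi
      · rfl
      · simp only [ups]; rw [hr i (by omega)]; rfl
    · simp only [ups]; rw [hk]; rfl
  | app t u ih₁ ih₂ =>
    simp only [bsubst, abstr]
    rw [ih₁ ht.1 (fun h => hx (Or.inl h)) hr hk, ih₂ ht.2 (fun h => hx (Or.inr h)) hr hk]

/-- The induction is on size because the opened body of an abstraction is not a subterm of it;
closing preserves size, so the opened body is still smaller. -/
theorem exists_toATm_eq [Infinite N] {t : ATm N B C} {a : Ty B} (h : HasType ct [] t a) :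
    ∃ n : Tm N B C, Tm.HasType ct n a ∧ n.toATm = t := by
  induction hk : t.size using Nat.strong_induction_on generalizing t a with
  | _ k ih =>
    subst hk
    cases h with
    | bvar h => simp at h
    | fvar x => exact ⟨.var x, .var x, rfl⟩
    | const c => exact ⟨.const c, .const c, rfl⟩
    | @lam _ a b t h =>
      obtain ⟨x, rfl, hx⟩ := exists_fresh a t.afv_finite
      have key : abstr x 0 (inst (.fvar x) t) = t :=
        abstr_bsubst h.closed hx (by simp) rfl
      have hs : (inst (.fvar x) t).size < (ATm.lam x.type t).size := by
        rw [← size_abstr x 0, key]; exact Nat.lt_succ_self _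
      obtain ⟨n, hn, hn'⟩ := ih _ hs (h.inst (.fvar x)) rfl
      exact ⟨.lam x n, .lam hn, by simp only [Tm.toATm]; rw [hn', key]⟩
    | app h₁ h₂ =>
      obtain ⟨n, hn, hn'⟩ := ih _ (by simp only [size]; omega) h₁ rfl
      obtain ⟨m, hm, hm'⟩ := ih _ (by simp only [size]; omega) h₂ rfl
      exact ⟨.app n m, .app hn hm, by simp only [Tm.toATm]; rw [hn', hm']⟩

end ATm

namespace Tm

variable {ct : C → Ty B}

/-- Eta-long beta-normal forms and spines are well typed. -/
theorem long_spine_hasType (t : Tm N B C) :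
    (∀ a, Long ct t a → HasType ct t a) ∧ ∀ a, Spine ct t a → HasType ct t a := by
  induction t with
  | var x =>
    have h : ∀ a, Spine ct (.var x : Tm N B C) a → HasType ct (.var x) a := by
      rintro _ ⟨⟩; exact .var x
    exact ⟨by rintro _ (_ | h'); exact h _ h', h⟩
  | const c =>
    have h : ∀ a, Spine ct (.const c : Tm N B C) a → HasType ct (.const c : Tm N B C) a := by
      rintro _ ⟨⟩; exact .const c
    exact ⟨by rintro _ (_ | h'); exact h _ h', h⟩
  | lam x t ih =>
    refine ⟨?_, by rintro _ ⟨⟩⟩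
    rintro _ (h | h)
    · exact .lam (ih.1 _ h)
    · cases h
  | app t u ih₁ ih₂ =>
    have h : ∀ a, Spine ct (.app t u : Tm N B C) a → HasType ct (.app t u) a := by
      rintro _ (_ | _ | ⟨h₁, h₂⟩); exact .app (ih₁.2 _ h₁) (ih₂.1 _ h₂)
    exact ⟨by rintro _ (_ | h'); exact h _ h', h⟩

theorem Long.hasType {t : Tm N B C} {a : Ty B} (h : Long ct t a) : HasType ct t a :=
  (long_spine_hasType t).1 a h

theorem Spine.hasType {t : Tm N B C} {a : Ty B} (h : Spine ct t a) : HasType ct t a :=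
  (long_spine_hasType t).2 a h

end Tm

namespace ATm

variable {ct : C → Ty B}

/-- Reducibility for weak normalization. -/
def Red (ct : C → Ty B) : Ty B → ATm N B C → Prop
  | .base b, t => ∃ n : Tm N B C, Tm.Long ct n (.base b) ∧ Conv ct [] (.base b) t n.toATm
  | .arr a b, t => HasType ct [] t (.arr a b) ∧ ∀ u, Red ct a u → Red ct b (.app t u)

theorem Red.hasType {a : Ty B} {t : ATm N B C} (h : Red ct a t) : HasType ct [] t a := by
  cases a with
  | base b => obtain ⟨n, -, h⟩ := h; exact h.hasType.1
  | arr a b => exact h.1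

/-- Invariance under full conversion contains closure under beta expansion, which is what the
abstraction case of the fundamental lemma uses. -/
theorem Red.conv {a : Ty B} {t u : ATm N B C} (h : Red ct a t) (hu : Conv ct [] a u t) :
    Red ct a u := by
  induction a generalizing t u with
  | base b => obtain ⟨n, hn, h⟩ := h; exact ⟨n, hn, hu.trans h⟩
  | arr a b _ ih =>
    exact ⟨hu.hasType.1, fun v hv => ih (h.2 v hv) (hu.app (.refl hv.hasType))⟩

/-- The two halves need each other at arrow types: a reducible function is read back by applying it
to a reflected fresh variable, and a spine is reducible because its reducible arguments can be read
back. -/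
theorem red_reify_reflect [Infinite N] (a : Ty B) :
    (∀ t : ATm N B C, Red ct a t →
      ∃ n : Tm N B C, Tm.Long ct n a ∧ Conv ct [] a t n.toATm) ∧
    ∀ (t : ATm N B C) (n : Tm N B C), Tm.Spine ct n a → Conv ct [] a t n.toATm → Red ct a t := by
  induction a with
  | base b => exact ⟨fun t h => h, fun t n hn h => ⟨n, .spine hn, h⟩⟩
  | arr a b iha ihb =>
    constructor
    · rintro t ⟨ht, h⟩
      obtain ⟨x, rfl, hx⟩ := exists_fresh a t.afv_finite
      obtain ⟨n, hn, hc⟩ := ihb.1 _ (h _ (iha.2 _ (.var x) (.var x) (.refl (.fvar x))))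
      exact ⟨.lam x n, .lam hn, (Conv.eta_abstr ht hx).symm.trans (hc.lam_abstr x)⟩
    · intro t n hn h
      refine ⟨h.hasType.1, fun u hu => ?_⟩
      obtain ⟨m, hm, hc⟩ := iha.1 u hu
      exact ihb.2 _ (.app n m) (.app hn hm) (h.app hc)

/-- The fundamental lemma of logical relations, by induction on the typing derivation. -/
theorem red_of_hasType [Infinite N] {t : Tm N B C} {a : Ty B} (h : Tm.HasType ct t a)
    {s : Var N B → ATm N B C} (hs : ∀ x, Red ct x.type (s x)) : Red ct a (fsubst s t.toATm) := by
  induction h generalizing s with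
  | var x => exact hs x
  | const c => exact (red_reify_reflect _).2 _ (.const c) (.const c) (.refl (.const c))
  | @lam x b t h ih =>
    have hs' := fun x => (hs x).hasType
    refine ⟨h.toATm.lam_abstr.fsubst hs', fun u hu => ?_⟩
    refine (ih (s := upd s x u) fun y => ?_).conv (Conv.beta_fsubst hs' h.toATm hu.hasType)
    unfold upd; split
    · rename_i h; subst h; exact hu
    · exact hs y
  | app _ _ ih₁ ih₂ => exact (ih₁ hs).2 _ (ih₂ hs)

/-- Every typed term has an eta-long beta-normal form. -/
theorem exists_long [Infinite N] {t : ATm N B C} {a : Ty B} (h : HasType ct [] t a) :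
    ∃ n : Tm N B C, Tm.Long ct n a ∧ Conv ct [] a t n.toATm := by
  obtain ⟨n, hn, rfl⟩ := exists_toATm_eq h
  refine (red_reify_reflect a).1 _ ?_
  have := red_of_hasType hn (s := .fvar)
    fun x => (red_reify_reflect _).2 _ (.var x) (.var x) (.refl (.fvar x))
  rwa [fsubst_fvar] at this

end ATm

end HOPattern

-- Uniqueness of eta-long normal forms by evaluation in the full type structure.

namespace HOPattern

variable {N B C : Type*}

/-- The full type structure over families of terms, indexed by a supply of fresh names. -/
def Dom (N B C : Type*) : Ty B → Type _
  | .base _ => ℕ → ATm N B C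
  | .arr a b => Dom N B C a → Dom N B C b

/-- Elements of the type structure together with their type. -/
abbrev TDom (N B C : Type*) := (a : Ty B) × Dom N B C a

namespace ATm

variable {ct : C → Ty B}

/-- Evaluation in the full type structure, as a relation. -/
inductive Eval (fe : (x : Var N B) → Dom N B C x.type) (ce : (c : C) → Dom N B C (ct c)) :
    List (TDom N B C) → ATm N B C → TDom N B C → Prop
  | bvar {e : List (TDom N B C)} {i : ℕ} {d : TDom N B C} :
      e[i]? = some d → Eval fe ce e (.bvar i) d
  | fvar {e : List (TDom N B C)} (x : Var N B) : Eval fe ce e (.fvar x) ⟨x.type, fe x⟩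
  | const {e : List (TDom N B C)} (c : C) : Eval fe ce e (.const c) ⟨ct c, ce c⟩
  | lam {e : List (TDom N B C)} {a b : Ty B} {t : ATm N B C}
      (f : Dom N B C a → Dom N B C b) :
      (∀ v, Eval fe ce (⟨a, v⟩ :: e) t ⟨b, f v⟩) → Eval fe ce e (.lam a t) ⟨.arr a b, f⟩
  | app {e : List (TDom N B C)} {a b : Ty B} {t u : ATm N B C}
      (f : Dom N B C a → Dom N B C b) (v : Dom N B C a) :
      Eval fe ce e t ⟨.arr a b, f⟩ → Eval fe ce e u ⟨a, v⟩ → Eval fe ce e (.app t u) ⟨b, f v⟩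

variable {fe : (x : Var N B) → Dom N B C x.type} {ce : (c : C) → Dom N B C (ct c)}

theorem Eval.unique {e : List (TDom N B C)} {t : ATm N B C} {d d' : TDom N B C}
    (h : Eval fe ce e t d) (h' : Eval fe ce e t d') : d = d' := by
  induction h generalizing d' with
  | bvar h => cases h' with | bvar h' => rw [h] at h'; exact Option.some.inj h'
  | fvar x => cases h'; rfl
  | const c => cases h'; rfl
  | @lam e a b t f h ih =>
    cases h' with
    | @lam _ _ b' _ f' h' =>
      have key := fun v => ih v (h' v)
      -- The result type is visible only through values at points of the domain, so a point is
      -- needed. One exists at every type, since the term at hand inhabits the base domains.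
      by_cases hne : Nonempty (Dom N B C a)
      · obtain ⟨v⟩ := hne
        obtain rfl : b = b' := congrArg Sigma.fst (key v)
        obtain rfl : f = f' := funext fun v => by simpa using key v
        rfl
      · exfalso
        apply hne
        clear * - t
        induction a with
        | base b => exact ⟨fun _ => t⟩
        | arr a b _ ih => exact ⟨fun _ => ih.some⟩
  | app f v _ _ ih₁ ih₂ =>
    cases h' with
    | app f' v' h₁ h₂ =>
      have e₁ := ih₁ h₁
      have e₂ := ih₂ h₂
      cases e₁; cases e₂; rfl

theorem Eval.rename {e e' : List (TDom N B C)} {t : ATm N B C} {d : TDom N B C}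
    (h : Eval fe ce e t d) {r : ℕ → ℕ} (hr : ∀ i d, e[i]? = some d → e'[r i]? = some d) :
    Eval fe ce e' (rename r t) d := by
  induction h generalizing e' r with
  | bvar h => exact .bvar (hr _ _ h)
  | fvar x => exact .fvar x
  | const c => exact .const c
  | lam f _ ih =>
    refine .lam f fun v => ih v ?_
    rintro (_ | i) d hd
    · exact hd
    · exact hr i d hd
  | app f v _ _ ih₁ ih₂ => exact .app f v (ih₁ hr) (ih₂ hr)

theorem Eval.bsubst {e e' : List (TDom N B C)} {t : ATm N B C} {d : TDom N B C}
    (h : Eval fe ce e t d) {r : ℕ → ATm N B C}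
    (hr : ∀ i d, e[i]? = some d → Eval fe ce e' (r i) d) :
    Eval fe ce e' (bsubst r t) d := by
  induction h generalizing e' r with
  | bvar h => exact hr _ _ h
  | fvar x => exact .fvar x
  | const c => exact .const c
  | lam f _ ih =>
    refine .lam f fun v => ih v ?_
    rintro (_ | i) d hd
    · exact .bvar hd
    · exact (hr i d hd).rename fun _ _ h => h
  | app f v _ _ ih₁ ih₂ => exact .app f v (ih₁ hr) (ih₂ hr)

theorem Eval.inst {e : List (TDom N B C)} {t u : ATm N B C} {d d' : TDom N B C}
    (h : Eval fe ce (d' :: e) t d) (hu : Eval fe ce e u d') : Eval fe ce e (inst u t) d := by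
  refine h.bsubst ?_
  rintro (_ | i) c hc
  · obtain rfl : d' = c := by simpa using hc
    exact hu
  · exact .bvar hc

theorem HasType.exists_eval {Γ : List (Ty B)} {t : ATm N B C} {a : Ty B}
    (h : HasType ct Γ t a) {e : List (TDom N B C)} (he : e.map Sigma.fst = Γ) :
    ∃ v, Eval fe ce e t ⟨a, v⟩ := by
  induction h generalizing e with
  | @bvar Γ i a h =>
    subst he
    rw [List.getElem?_map, Option.map_eq_some_iff] at h
    obtain ⟨⟨a, v⟩, h, rfl⟩ := h
    exact ⟨v, .bvar h⟩
  | fvar x => exact ⟨_, .fvar x⟩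
  | const c => exact ⟨_, .const c⟩
  | @lam Γ a b t _ ih =>
    choose f hf using fun v => ih (e := ⟨a, v⟩ :: e) (by simp [he])
    exact ⟨f, .lam f hf⟩
  | app _ _ ih₁ ih₂ =>
    obtain ⟨f, hf⟩ := ih₁ he
    obtain ⟨v, hv⟩ := ih₂ he
    exact ⟨f v, .app f v hf hv⟩

/-- The model is sound for typed beta-eta-equality. -/
theorem Conv.exists_eval {Γ : List (Ty B)} {t u : ATm N B C} {a : Ty B}
    (h : Conv ct Γ a t u) {e : List (TDom N B C)} (he : e.map Sigma.fst = Γ) :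
    ∃ v, Eval fe ce e t ⟨a, v⟩ ∧ Eval fe ce e u ⟨a, v⟩ := by
  induction h generalizing e with
  | refl h => obtain ⟨v, hv⟩ := h.exists_eval he; exact ⟨v, hv, hv⟩
  | symm _ ih => obtain ⟨v, h₁, h₂⟩ := ih he; exact ⟨v, h₂, h₁⟩
  | trans _ _ ih₁ ih₂ =>
    obtain ⟨v, h₁, h₂⟩ := ih₁ he
    obtain ⟨w, h₃, h₄⟩ := ih₂ he
    cases h₂.unique h₃
    exact ⟨v, h₁, h₄⟩
  | @lam Γ a b t u _ ih =>
    choose f hf using fun v => ih (e := ⟨a, v⟩ :: e) (by simp [he])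
    exact ⟨f, .lam f fun v => (hf v).1, .lam f fun v => (hf v).2⟩
  | app _ _ ih₁ ih₂ =>
    obtain ⟨f, h₁, h₂⟩ := ih₁ he
    obtain ⟨v, h₃, h₄⟩ := ih₂ he
    exact ⟨f v, .app f v h₁ h₃, .app f v h₂ h₄⟩
  | @beta Γ a b t u h₁ h₂ =>
    choose f hf using fun v => h₁.exists_eval (fe := fe) (ce := ce) (e := ⟨a, v⟩ :: e)
      (by simp [he])
    obtain ⟨v, hv⟩ := h₂.exists_eval (fe := fe) (ce := ce) he
    exact ⟨f v, .app f v (.lam f hf) hv, (hf v).inst hv⟩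
  | @eta Γ a b t h =>
    obtain ⟨f, hf⟩ := h.exists_eval (fe := fe) (ce := ce) he
    exact ⟨f, .lam f fun v => .app f v (hf.rename fun _ _ h => h) (.bvar rfl), hf⟩

open Classical in
/-- `updD fe x v` maps `x` to `v` and is `fe` elsewhere. -/
noncomputable def updD (fe : (x : Var N B) → Dom N B C x.type) (x : Var N B)
    (v : Dom N B C x.type) : (y : Var N B) → Dom N B C y.type := Function.update fe x v

/-- The value assigned to `x` moves from the free environment to the far end of the indexed one,
parallel to the typing of abstraction. -/
theorem Eval.abstr {x : Var N B} {v : Dom N B C x.type} {e : List (TDom N B C)}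
    {t : ATm N B C} {d : TDom N B C} (h : Eval (updD fe x v) ce e t d) :
    Eval fe ce (e ++ [⟨x.type, v⟩]) (abstr x e.length t) d := by
  induction h with
  | bvar h =>
    have := (List.getElem?_eq_some_iff.1 h).1
    exact .bvar (by rw [List.getElem?_append_left this, h])
  | fvar y =>
    simp only [ATm.abstr]; split
    · rename_i h; subst h
      simp only [updD, Function.update_self]
      exact .bvar (by simp)
    · rename_i h
      simp only [updD, ne_eq, h, not_false_eq_true, Function.update_of_ne]
      exact .fvar y
  | const c => exact .const c
  | lam f _ ih => exact .lam f ih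
  | app f v _ _ ih₁ ih₂ => exact .app f v ih₁ ih₂

/-- Reification at every type, and reflection of a family of neutral terms; `y k` is the `k`-th
fresh name. -/
noncomputable def reifyReflect (y : ℕ → N) :
    (a : Ty B) → (Dom N B C a → ℕ → ATm N B C) × ((ℕ → ATm N B C) → Dom N B C a)
  | .base _ => (id, id)
  | .arr a b =>
    (fun f k => .lam a (ATm.abstr ⟨y k, a⟩ 0
      ((reifyReflect y b).1 (f ((reifyReflect y a).2 fun _ => .fvar ⟨y k, a⟩)) (k + 1))),
     fun r v => (reifyReflect y b).2 fun k => .app (r k) ((reifyReflect y a).1 v k))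

/-- Reification. -/
noncomputable def reify (y : ℕ → N) (a : Ty B) : Dom N B C a → ℕ → ATm N B C :=
  (reifyReflect y a).1

/-- Reflection. -/
noncomputable def reflect (y : ℕ → N) (a : Ty B) : (ℕ → ATm N B C) → Dom N B C a :=
  (reifyReflect y a).2

theorem reify_lam (y : ℕ → N) (a b : Ty B) (f : Dom N B C (.arr a b)) (k : ℕ) :
    reify y (.arr a b) f k = .lam a (ATm.abstr ⟨y k, a⟩ 0
      (reify y b (f (reflect y a fun _ => .fvar ⟨y k, a⟩)) (k + 1))) := rfl

/-- The environment that reflects a renaming of the variables. -/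
noncomputable def reflectEnv (y : ℕ → N) (s : Var N B → Var N B) (x : Var N B) :
    Dom N B C x.type := reflect y x.type fun _ => .fvar (s x)

theorem upd_fvar (s : Var N B → Var N B) (x z : Var N B) :
    ∃ s' : Var N B → Var N B, s' x = z ∧ (∀ w ≠ x, s' w = s w) ∧
      upd (C := C) (fun w => .fvar (s w)) x (.fvar z) = fun w => .fvar (s' w) := by
  classical
  refine ⟨Function.update s x z, by simp, fun w hw => by simp [hw], ?_⟩
  funext w
  by_cases hw : w = x
  · subst hw; simp
  · simp [upd, hw]

theorem updD_reflectEnv {y : ℕ → N} {s s' : Var N B → Var N B} {x z : Var N B} (h : s' x = z)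
    (h' : ∀ w ≠ x, s' w = s w) :
    updD (C := C) (reflectEnv y s) x (reflect y x.type fun _ => .fvar z) = reflectEnv y s' := by
  funext w
  by_cases hw : w = x
  · subst hw; simp [updD, reflectEnv, h]
  · classical
    simp only [updD, Function.update_of_ne hw, reflectEnv, h' w hw]

end ATm

namespace Tm

open ATm

variable {ct : C → Ty B}

/-- Evaluation and reification of an eta-long beta-normal form, from index `k₀` on. -/
def LongSound (ct : C → Ty B) (y : ℕ → N) (t : Tm N B C) (a : Ty B) : Prop :=
  ∀ (s : Var N B → Var N B) (k₀ : ℕ), (∀ k ≥ k₀, ∀ x ∈ t.fv, (s x).name ≠ y k) →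
    ∃ v, Eval (reflectEnv y s) (fun c => reflect y (ct c) fun _ => .const c) [] t.toATm ⟨a, v⟩ ∧
      ∀ k ≥ k₀, reify y a v k = fsubst (fun x => .fvar (s x)) t.toATm

/-- Evaluation of a spine, from index `k₀` on. -/
def SpineSound (ct : C → Ty B) (y : ℕ → N) (t : Tm N B C) (a : Ty B) : Prop :=
  ∀ (s : Var N B → Var N B) (k₀ : ℕ), (∀ k ≥ k₀, ∀ x ∈ t.fv, (s x).name ≠ y k) →
    ∃ r : ℕ → ATm N B C,
      Eval (reflectEnv y s) (fun c => reflect y (ct c) fun _ => .const c) [] t.toATm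
        ⟨a, reflect y a r⟩ ∧
      ∀ k ≥ k₀, r k = fsubst (fun x => .fvar (s x)) t.toATm

theorem SpineSound.long {y : ℕ → N} {t : Tm N B C} {b : B} (h : SpineSound ct y t (.base b)) :
    LongSound ct y t (.base b) := fun s k₀ hk => by
  obtain ⟨r, hr, hr'⟩ := h s k₀ hk
  exact ⟨r, hr, hr'⟩

/-- Reification at `k` consumes the name `y k` for the binder, so the body is evaluated with `x`
renamed to that name and read back from `k + 1` on, where injectivity of `y` keeps the supply fresh.
-/
theorem LongSound.lam {y : ℕ → N} (hy : y.Injective) {x : Var N B} {t : Tm N B C} {b : Ty B}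
    (ht : HasType ct t b) (h : LongSound ct y t b) :
    LongSound ct y (.lam x t) (.arr x.type b) := fun s k₀ hk => by
  obtain ⟨f, hf⟩ := ht.toATm.lam_abstr (x := x) |>.exists_eval (fe := reflectEnv y s)
    (ce := fun c => reflect y (ct c) fun _ => .const c) (e := []) rfl
  refine ⟨f, hf, fun k hk' => ?_⟩
  cases hf with
  | lam f hf =>
    obtain ⟨s', hx, hne, hs'⟩ := upd_fvar (C := C) s x ⟨y k, x.type⟩
    obtain ⟨v, hv, hv'⟩ := h s' (k + 1) fun l hl z hz => by
      by_cases hzx : z = x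
      · subst hzx
        rw [hx]
        intro he
        have := hy he
        omega
      · rw [hne z hzx]
        exact hk l (by omega) z ⟨hz, hzx⟩
    rw [← updD_reflectEnv hx hne] at hv
    have e : f (reflect y x.type fun _ => .fvar ⟨y k, x.type⟩) = v := by
      simpa using (hf _).unique hv.abstr
    rw [reify_lam, e, hv' _ le_rfl, ← hs', toATm, fsubst, fsubst_abstr]
    -- The binder `y k` captures nothing, since no free variable of the abstraction is renamed to
    -- that name.
    intro z hz hzx hm
    rw [afv_toATm] at hz
    exact hk k hk' z ⟨hz, hzx⟩ (by rw [← show _ = s z from hm])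

theorem sound_of_long_spine {y : ℕ → N} (hy : y.Injective) (t : Tm N B C) :
    (∀ a, Long ct t a → LongSound ct y t a) ∧ ∀ a, Spine ct t a → SpineSound ct y t a := by
  induction t with
  | var x =>
    have h : ∀ a, Spine ct (.var x : Tm N B C) a → SpineSound ct y (.var x : Tm N B C) a := by
      rintro _ ⟨⟩ s k₀ hk
      exact ⟨fun _ => .fvar (s x), .fvar x, fun _ _ => rfl⟩
    exact ⟨by rintro _ (_ | h'); exact (h _ h').long, h⟩
  | const c =>
    have h : ∀ a, Spine ct (.const c : Tm N B C) a → SpineSound ct y (.const c : Tm N B C) a := by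
      rintro _ ⟨⟩ s k₀ hk
      exact ⟨fun _ => .const c, .const c, fun _ _ => rfl⟩
    exact ⟨by rintro _ (_ | h'); exact (h _ h').long, h⟩
  | lam x t ih =>
    refine ⟨?_, by rintro _ ⟨⟩⟩
    rintro _ (h | h)
    · exact (ih.1 _ h).lam hy h.hasType
    · cases h
  | app t u ih₁ ih₂ =>
    have h : ∀ a, Spine ct (.app t u : Tm N B C) a → SpineSound ct y (.app t u) a := by
      rintro _ (_ | _ | ⟨h₁, h₂⟩) s k₀ hk
      obtain ⟨r, hr, hr'⟩ := ih₁.2 _ h₁ s k₀ fun k hk' x hx => hk k hk' x (Or.inl hx)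
      obtain ⟨v, hv, hv'⟩ := ih₂.1 _ h₂ s k₀ fun k hk' x hx => hk k hk' x (Or.inr hx)
      refine ⟨fun k => .app (r k) (reify y _ v k), .app _ v hr hv, fun k hk' => ?_⟩
      simp only [toATm, fsubst]
      rw [hr' k hk', hv' k hk']
    exact ⟨by rintro _ (_ | h'); exact (h _ h').long, h⟩

/-- Eta-long beta-normal forms are unique. -/
theorem Long.toATm_eq [Infinite N] {t u : Tm N B C} {a : Ty B} (ht : Long ct t a)
    (hu : Long ct u a) (h : Conv ct [] a t.toATm u.toATm) : t.toATm = u.toATm := by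
  have e := Infinite.natEmbedding N
  -- Only finitely many names occur in the two terms, so the supply is fresh from some index on.
  obtain ⟨k₀, hk₀⟩ : ∃ k₀, ∀ k ≥ k₀, e k ∉ Var.name '' (t.fv ∪ u.fv) := by
    have := (((t.fv_finite.union u.fv_finite).image Var.name).preimage
      (e.injective.injOn)).bddAbove
    obtain ⟨k₀, hk₀⟩ := this
    exact ⟨k₀ + 1, fun k hk hk' => by have := hk₀ hk'; omega⟩
  have hs : ∀ n : Tm N B C, n.fv ⊆ t.fv ∪ u.fv → ∀ k ≥ k₀, ∀ x ∈ n.fv, (id x).name ≠ e k :=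
    fun n hn k hk x hx hxk => hk₀ k hk ⟨x, hn hx, hxk⟩
  obtain ⟨v, hv, hv'⟩ := (sound_of_long_spine e.injective t).1 a ht id k₀
    (hs t Set.subset_union_left)
  obtain ⟨w, hw, hw'⟩ := (sound_of_long_spine e.injective u).1 a hu id k₀
    (hs u Set.subset_union_right)
  -- Convertible terms have one common value, and each normal form is recovered as its reification
  -- at `k₀`.
  obtain ⟨d, h₁, h₂⟩ := h.exists_eval (fe := reflectEnv e id)
    (ce := fun c => reflect e (ct c) fun _ => .const c) (e := []) rfl
  cases hv.unique h₁
  cases hw.unique h₂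
  have := (hv' k₀ le_rfl).symm.trans (hw' k₀ le_rfl)
  simpa only [id, fsubst_fvar] using this

end Tm

end HOPattern

-- Type preserving permutations and iterated abstraction and application.

namespace HOPattern

variable {N B C : Type*}

/-- The type preserving permutations of the variables in `V`. -/
def varPerm (V : Set (Var N B)) : Subgroup (Equiv.Perm (Var N B)) where
  carrier := {π | (∀ x, (π x).type = x.type) ∧ ∀ x ∉ V, π x = x}
  mul_mem' := by
    rintro π ρ ⟨h₁, h₂⟩ ⟨h₃, h₄⟩
    refine ⟨fun x => by simp [h₁, h₃], fun x hx => by simp [h₄ x hx, h₂ x hx]⟩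
  one_mem' := ⟨fun _ => rfl, fun _ _ => rfl⟩
  inv_mem' := by
    rintro π ⟨h₁, h₂⟩
    refine ⟨fun x => ?_, fun x hx => ?_⟩
    · have := h₁ (π⁻¹ x)
      simpa using this.symm
    · rw [Equiv.Perm.inv_eq_iff_eq, h₂ x hx]

namespace varPerm

variable {V : Set (Var N B)} {π : Equiv.Perm (Var N B)}

theorem type_eq (hπ : π ∈ varPerm V) (x : Var N B) : (π x).type = x.type := hπ.1 x

theorem apply_mem (hπ : π ∈ varPerm V) {x : Var N B} (hx : x ∈ V) : π x ∈ V := by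
  by_contra h
  have := hπ.2 _ h
  rw [π.injective this] at h
  exact h hx

open Classical in
theorem swap_mem {x y : Var N B} (hx : x ∈ V) (hy : y ∈ V) (h : x.type = y.type) :
    Equiv.swap x y ∈ varPerm V := by
  refine ⟨fun z => ?_, fun z hz => ?_⟩
  · rw [Equiv.swap_apply_def]; split_ifs <;> simp_all
  · exact Equiv.swap_apply_of_ne_of_ne (by rintro rfl; exact hz hx) (by rintro rfl; exact hz hy)

/-- A partial bijection between variables of `V` extends to a permutation. -/
theorem exists_map_eq {xs ys : List (Var N B)} (hxs : xs.Nodup) (hys : ys.Nodup)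
    (hxV : ∀ x ∈ xs, x ∈ V) (hyV : ∀ y ∈ ys, y ∈ V)
    (h : xs.map Var.type = ys.map Var.type) : ∃ π ∈ varPerm V, xs.map π = ys := by
  classical
  induction xs generalizing ys with
  | nil => cases ys with
    | nil => exact ⟨1, one_mem _, rfl⟩
    | cons y ys => simp at h
  | cons x xs ih => cases ys with
    | nil => simp at h
    | cons y ys =>
      simp only [List.map_cons, List.cons.injEq, List.nodup_cons, List.forall_mem_cons] at *
      obtain ⟨π, hπ, hm⟩ := ih hxs.2 hys.2 hxV.2 hyV.2 h.2
      -- The transposition corrects the image of `x`. It leaves the other images alone: they differ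
      -- from `π x` by injectivity and from `y` because `y` is not repeated.
      refine ⟨Equiv.swap (π x) y * π, mul_mem (swap_mem (apply_mem hπ hxV.1) hyV.1
        ((type_eq hπ x).trans h.1)) hπ, by simp, ?_⟩
      rw [← hm]
      refine List.map_congr_left fun z hz => ?_
      refine Equiv.swap_apply_of_ne_of_ne (fun e => ?_) (fun e => ?_)
      · rw [π.injective e] at hz; exact hxs.1 hz
      · exact hys.1 (hm ▸ e ▸ List.mem_map_of_mem hz)

end varPerm

/-- `ν₁ → ⋯ → νₘ → a`. -/
def Ty.arrs (l : List (Ty B)) (a : Ty B) : Ty B := l.foldr .arr a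

theorem Ty.args_arrs (l : List (Ty B)) (b : B) : (Ty.arrs l (.base b)).args = l := by
  induction l with
  | nil => rfl
  | cons a l ih => exact congrArg (a :: ·) ih

theorem Ty.arrs_base_inj {l l' : List (Ty B)} {b b' : B}
    (h : Ty.arrs l (.base b) = Ty.arrs l' (.base b')) : l = l' ∧ b = b' := by
  have hl : l = l' := by rw [← Ty.args_arrs l b, h, Ty.args_arrs]
  refine ⟨hl, ?_⟩
  subst hl
  induction l with
  | nil => injection h
  | cons a l ih => injection h with _ h; exact ih h

namespace ATm

/-- The action of a permutation of the free variables. -/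
def perm (π : Equiv.Perm (Var N B)) (t : ATm N B C) : ATm N B C := fsubst (fun x => .fvar (π x)) t

theorem perm_one (t : ATm N B C) : perm 1 t = t := fsubst_fvar t

theorem perm_mul (π ρ : Equiv.Perm (Var N B)) (t : ATm N B C) :
    perm (π * ρ) t = perm π (perm ρ t) :=
  (fsubst_fsubst (fun x => .fvar (π x)) (fun x => .fvar (ρ x)) t).symm

theorem mem_afv_perm {π : Equiv.Perm (Var N B)} {t : ATm N B C} {y : Var N B} :
    y ∈ (perm π t).afv ↔ ∃ x ∈ t.afv, y = π x := by
  rw [perm, mem_afv_fsubst]; rfl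

/-- Free occurrences stay visible after a permutation, so the result determines it on the free
variables. This makes the arguments of a generalization leaf unique. -/
theorem eq_of_perm_eq {π ρ : Equiv.Perm (Var N B)} {t : ATm N B C} (h : perm π t = perm ρ t)
    {x : Var N B} (hx : x ∈ t.afv) : π x = ρ x := by
  induction t with
  | bvar i => cases hx
  | fvar y =>
    obtain rfl : x = y := hx
    simpa [perm, fsubst] using h
  | const c => cases hx
  | lam a t ih => simp only [perm, fsubst, ATm.lam.injEq] at h; exact ih h.2 hx
  | app t u ih₁ ih₂ =>
    simp only [perm, fsubst, ATm.app.injEq] at h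
    exact hx.elim (ih₁ h.1) (ih₂ h.2)

theorem perm_abstr (π : Equiv.Perm (Var N B)) (x : Var N B) (k : ℕ) (t : ATm N B C) :
    perm π (abstr x k t) = abstr (π x) k (perm π t) :=
  fsubst_abstr_self k (fun z _ hzx h => hzx (π.injective (show π x = π z from h).symm)) rfl

/-- Alpha conversion in the form of a transposition: neither of the two variables is free in the
abstraction, so swapping them fixes it. -/
theorem abstr_swap [DecidableEq (Var N B)] {x y : Var N B} {t : ATm N B C}
    (h : x ∉ (abstr y 0 t).afv) :
    abstr x 0 (perm (Equiv.swap x y) t) = abstr y 0 t := by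
  have := perm_abstr (Equiv.swap x y) y 0 t
  rw [Equiv.swap_apply_right] at this
  rw [← this]
  refine fsubst_eq_self fun z hz => ?_
  rw [Equiv.swap_apply_of_ne_of_ne]
  · rintro rfl; exact h hz
  · rintro rfl; rw [afv_abstr] at hz; exact hz.2 rfl

variable {ct : C → Ty B}

theorem hasType_fvar_perm {V : Set (Var N B)} {π : Equiv.Perm (Var N B)} (hπ : π ∈ varPerm V)
    (x : Var N B) : HasType ct [] (.fvar (π x) : ATm N B C) x.type := by
  rw [← varPerm.type_eq hπ x]; exact .fvar _

theorem Conv.perm {V : Set (Var N B)} {π : Equiv.Perm (Var N B)} (hπ : π ∈ varPerm V)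
    {a : Ty B} {t u : ATm N B C} (h : Conv ct [] a t u) :
    Conv ct [] a (ATm.perm π t) (ATm.perm π u) := h.fsubst (hasType_fvar_perm hπ)

theorem HasType.perm {V : Set (Var N B)} {π : Equiv.Perm (Var N B)} (hπ : π ∈ varPerm V)
    {a : Ty B} {t : ATm N B C} (h : HasType ct [] t a) :
    HasType ct [] (ATm.perm π t) a := h.fsubst (hasType_fvar_perm hπ)

/-- `h(t₁, …, tₘ)`. -/
def apps (h : ATm N B C) (ts : List (ATm N B C)) : ATm N B C := ts.foldl .app h

/-- `λ x₁ … xₙ. t`. -/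
noncomputable def lams (xs : List (Var N B)) (t : ATm N B C) : ATm N B C :=
  xs.foldr (fun x t => .lam x.type (abstr x 0 t)) t

theorem HasType.lams (xs : List (Var N B)) {t : ATm N B C} {a : Ty B} (h : HasType ct [] t a) :
    HasType ct [] (lams xs t) (Ty.arrs (xs.map Var.type) a) := by
  induction xs with
  | nil => exact h
  | cons x xs ih => exact ih.lam_abstr

theorem Conv.lams (xs : List (Var N B)) {t u : ATm N B C} {a : Ty B} (h : Conv ct [] a t u) :
    Conv ct [] (Ty.arrs (xs.map Var.type) a) (lams xs t) (lams xs u) := by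
  induction xs with
  | nil => exact h
  | cons x xs ih => exact ih.lam_abstr x

theorem Conv.apps {a : Ty B} {tys : List (Ty B)} {t u : ATm N B C} {ts us : List (ATm N B C)}
    (h : Conv ct [] (Ty.arrs tys a) t u)
    (hts : List.Forall₂ (fun (p : ATm N B C × ATm N B C) b => Conv ct [] b p.1 p.2)
      (ts.zip us) tys) (hl : ts.length = us.length) :
    Conv ct [] a (apps t ts) (apps u us) := by
  induction ts generalizing us tys t u with
  | nil =>
    cases us with
    | nil => cases hts; exact h
    | cons u us => simp at hl
  | cons t' ts ih =>
    cases us with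
    | nil => simp at hl
    | cons u' us =>
      cases hts with
      | @cons _ _ _ tys h₁ h₂ =>
        exact ih (tys := tys) (t := .app t t') (u := .app u u') (us := us) (.app h h₁) h₂
          (by simpa using hl)

theorem mem_afv_lams {xs : List (Var N B)} {t : ATm N B C} {y : Var N B} :
    y ∈ (lams xs t).afv ↔ y ∈ t.afv ∧ y ∉ xs := by
  induction xs with
  | nil => simp [lams]
  | cons x xs ih =>
    change y ∈ (abstr x 0 (lams xs t)).afv ↔ _
    rw [afv_abstr, Set.mem_sdiff, ih]
    simp; tauto

theorem fsubst_apps (s : Var N B → ATm N B C) (h : ATm N B C) (ts : List (ATm N B C)) :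
    fsubst s (apps h ts) = apps (fsubst s h) (ts.map (fsubst s)) := by
  induction ts generalizing h with
  | nil => rfl
  | cons t ts ih => exact ih _

theorem fsubst_lams {s : Var N B → ATm N B C} {xs : List (Var N B)} {t : ATm N B C}
    (hx : ∀ x ∈ xs, s x = .fvar x) (h : ∀ z ∈ t.afv, z ∉ xs → ∀ x ∈ xs, x ∉ (s z).afv) :
    fsubst s (lams xs t) = lams xs (fsubst s t) := by
  induction xs with
  | nil => rfl
  | cons x xs ih =>
    simp only [lams, List.foldr_cons, fsubst] at *
    rw [fsubst_abstr_self 0 _ (hx x List.mem_cons_self), ih]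
    · exact fun y hy => hx y (List.mem_cons_of_mem _ hy)
    · intro z hz hzx y hy hyz
      by_cases hzx' : z = x
      · subst hzx'
        rw [hx z List.mem_cons_self] at hyz
        exact hzx ((show y = z from hyz) ▸ hy)
      · exact h z hz (by simp [hzx, hzx']) y (List.mem_cons_of_mem _ hy) hyz
    · intro z hz hzx hxz
      have hz' := mem_afv_lams.1 hz
      exact h z hz'.1 (by simp [hzx, hz'.2]) x List.mem_cons_self hxz

/-- Each beta step updates the substitution at one binder. Since the binders are distinct, no later
update overwrites an earlier one, and the result is a single simultaneous substitution. -/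
theorem Conv.apps_fsubst_lams {xs : List (Var N B)} {us : List (ATm N B C)} {t : ATm N B C}
    {a : Ty B} (ht : HasType ct [] t a) (hxs : xs.Nodup)
    (hus : List.Forall₂ (fun u (x : Var N B) => HasType ct [] u x.type) us xs)
    {s : Var N B → ATm N B C} (hs : ∀ x, HasType ct [] (s x) x.type) :
    ∃ s' : Var N B → ATm N B C, (∀ x, HasType ct [] (s' x) x.type) ∧ (∀ y ∉ xs, s' y = s y) ∧
      List.Forall₂ (fun u x => s' x = u) us xs ∧
      Conv ct [] a (ATm.apps (ATm.fsubst s (ATm.lams xs t)) us) (ATm.fsubst s' t) := by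
  induction hus generalizing s with
  | nil => exact ⟨s, hs, fun _ _ => rfl, .nil, .refl (ht.fsubst hs)⟩
  | @cons u x us xs hu hus ih =>
    rw [List.nodup_cons] at hxs
    obtain ⟨s', h₁, h₂, h₃, h₄⟩ := ih hxs.2 (s := upd s x u) (HasType.upd hs hu)
    refine ⟨s', h₁, fun y hy => ?_, .cons ?_ h₃, ?_⟩
    · rw [List.mem_cons, not_or] at hy
      rw [h₂ y hy.2, upd_of_ne _ _ hy.1]
    · rw [h₂ x hxs.1, upd_self]
    · refine .trans (Conv.apps (tys := xs.map Var.type) (us := us)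
        (t := .app (ATm.fsubst s (ATm.lams (x :: xs) t)) u) (Conv.beta_fsubst hs (ht.lams xs) hu) ?_ rfl) h₄
      clear * - hus
      induction hus with
      | nil => exact .nil
      | cons h _ ih => exact .cons (.refl h) ih

theorem Conv.lams_apps {xs : List (Var N B)} {t : ATm N B C} {a : Ty B}
    (ht : HasType ct [] t (Ty.arrs (xs.map Var.type) a)) (hxs : xs.Nodup)
    (h : ∀ x ∈ xs, x ∉ t.afv) :
    Conv ct [] (Ty.arrs (xs.map Var.type) a)
      (ATm.lams xs (ATm.apps t (xs.map .fvar))) t := by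
  induction xs generalizing t with
  | nil => exact .refl ht
  | cons x xs ih =>
    rw [List.nodup_cons] at hxs
    refine .trans (Conv.lam_abstr x (ih (t := .app t (.fvar x)) (.app ht (.fvar x)) hxs.2 ?_))
      (Conv.eta_abstr ht (h x List.mem_cons_self))
    rintro y hy (hy' | hy')
    · exact h y (List.mem_cons_of_mem _ hy) hy'
    · exact hxs.1 ((show y = x from hy') ▸ hy)

end ATm

namespace Tm

variable {ct : C → Ty B}

/-- The action of a permutation of the variables, bound ones included. -/
def perm (π : Equiv.Perm (Var N B)) : Tm N B C → Tm N B C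
  | .var x => .var (π x)
  | .const c => .const c
  | .lam x t => .lam (π x) (t.perm π)
  | .app t u => .app (t.perm π) (u.perm π)

/-- `λ x₁ … xₙ. t`. -/
def lams (xs : List (Var N B)) (t : Tm N B C) : Tm N B C := xs.foldr .lam t

theorem toATm_lams (xs : List (Var N B)) (t : Tm N B C) :
    (lams xs t).toATm = ATm.lams xs t.toATm := by
  induction xs with
  | nil => rfl
  | cons x xs ih => simp only [lams, ATm.lams, List.foldr_cons, toATm] at *; rw [ih]

theorem toATm_apps (h : Tm N B C) (ts : List (Tm N B C)) :
    (apps h ts).toATm = ATm.apps h.toATm (ts.map toATm) := by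
  induction ts generalizing h with
  | nil => rfl
  | cons t ts ih => exact ih _

theorem Long.lams (xs : List (Var N B)) {t : Tm N B C} {a : Ty B} (h : Long ct t a) :
    Long ct (lams xs t) (Ty.arrs (xs.map Var.type) a) := by
  induction xs with
  | nil => exact h
  | cons x xs ih => exact .lam ih

theorem mem_bv_lams {xs : List (Var N B)} {t : Tm N B C} {y : Var N B} :
    y ∈ (lams xs t).bv ↔ y ∈ xs ∨ y ∈ t.bv := by
  induction xs with
  | nil => simp [lams]
  | cons x xs ih =>
    change y ∈ insert x (lams xs t).bv ↔ _
    rw [Set.mem_insert_iff, ih]; simp [or_assoc]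

theorem mem_bv_apps {h : Tm N B C} {ts : List (Tm N B C)} {y : Var N B} :
    y ∈ (apps h ts).bv ↔ y ∈ h.bv ∨ ∃ t ∈ ts, y ∈ t.bv := by
  induction ts generalizing h with
  | nil => simp [apps]
  | cons t ts ih =>
    change y ∈ (apps (.app h t) ts).bv ↔ _
    rw [ih]
    simp [bv, or_assoc]

theorem mem_fv_apps {h : Tm N B C} {ts : List (Tm N B C)} {y : Var N B} :
    y ∈ (apps h ts).fv ↔ y ∈ h.fv ∨ ∃ t ∈ ts, y ∈ t.fv := by
  induction ts generalizing h with
  | nil => simp [apps]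
  | cons t ts ih =>
    change y ∈ (apps (.app h t) ts).fv ↔ _
    rw [ih]
    simp [fv, or_assoc]

theorem perm_apps (π : Equiv.Perm (Var N B)) (h : Tm N B C) (ts : List (Tm N B C)) :
    (apps h ts).perm π = apps (h.perm π) (ts.map (perm π)) := by
  induction ts generalizing h with
  | nil => rfl
  | cons t ts ih => exact ih _

theorem mem_bv_perm {π : Equiv.Perm (Var N B)} {t : Tm N B C} {y : Var N B} :
    y ∈ (t.perm π).bv ↔ ∃ x ∈ t.bv, y = π x := by
  induction t with
  | var x => simp [perm, bv]
  | const c => simp [perm, bv]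
  | lam x t ih => simp [perm, bv, ih]
  | app t u ih₁ ih₂ =>
    simp only [perm, bv, Set.mem_union, ih₁, ih₂]
    grind

variable {V : Set (Var N B)} {π : Equiv.Perm (Var N B)}

theorem toATm_perm (hπ : π ∈ varPerm V) (t : Tm N B C) :
    (t.perm π).toATm = t.toATm.perm π := by
  induction t with
  | var x => rfl
  | const c => rfl
  | lam x t ih =>
    simp only [perm, toATm, varPerm.type_eq hπ, ih, ← ATm.perm_abstr]
    rfl
  | app t u ih₁ ih₂ => simp only [perm, toATm, ih₁, ih₂]; rfl

theorem long_spine_perm (hπ : π ∈ varPerm V) (t : Tm N B C) :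
    (∀ a, Long ct t a → Long ct (t.perm π) a) ∧ ∀ a, Spine ct t a → Spine ct (t.perm π) a := by
  induction t with
  | var x =>
    have h : ∀ a, Spine ct (.var x : Tm N B C) a → Spine ct (.var (π x) : Tm N B C) a := by
      rintro _ ⟨⟩; rw [← varPerm.type_eq hπ x]; exact .var _
    exact ⟨by rintro _ (_ | h'); exact .spine (h _ h'), h⟩
  | const c => exact ⟨fun _ h => h, fun _ h => h⟩
  | lam x t ih =>
    refine ⟨?_, by rintro _ ⟨⟩⟩
    rintro _ (h | h)
    · rw [← varPerm.type_eq hπ x]; exact .lam (ih.1 _ h)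
    · cases h
  | app t u ih₁ ih₂ =>
    have h : ∀ a, Spine ct (.app t u : Tm N B C) a → Spine ct ((app t u).perm π) a := by
      rintro _ (_ | _ | ⟨h₁, h₂⟩); exact .app (ih₁.2 _ h₁) (ih₂.1 _ h₂)
    exact ⟨by rintro _ (_ | h'); exact .spine (h _ h'), h⟩

theorem Long.perm (hπ : π ∈ varPerm V) {t : Tm N B C} {a : Ty B} (h : Long ct t a) :
    Long ct (t.perm π) a := (long_spine_perm hπ t).1 a h

theorem IsVar.perm (hπ : π ∈ varPerm V)
    {t : Tm N B C} {x : Var N B} (h : IsVar ct t x) : IsVar ct (t.perm π) (π x) := by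
  unfold IsVar
  rw [toATm_perm hπ, varPerm.type_eq hπ]
  exact ATm.Conv.perm hπ h

end Tm

-- The normal form as a function.

namespace ATm

variable [Infinite N] {ct : C → Ty B}

open Classical in
/-- The eta-long beta-normal form. -/
noncomputable def nf (ct : C → Ty B) (t : ATm N B C) : ATm N B C :=
  if h : ∃ a, HasType ct [] t a then (exists_long h.choose_spec).choose.toATm else t

theorem nf_spec {a : Ty B} {t : ATm N B C} (h : HasType ct [] t a) :
    ∃ n : Tm N B C, Tm.Long ct n a ∧ n.toATm = nf ct t ∧ Conv ct [] a t (nf ct t) := by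
  have h' : ∃ a, HasType ct [] t a := ⟨a, h⟩
  have := (exists_long h'.choose_spec).choose_spec
  simp only [nf, h', dif_pos]
  rw [h.unique h'.choose_spec]
  exact ⟨_, this.1, rfl, this.2⟩

theorem conv_nf {a : Ty B} {t : ATm N B C} (h : HasType ct [] t a) :
    Conv ct [] a t (nf ct t) := let ⟨_, _, _, h⟩ := nf_spec h; h

/-- Uniqueness makes the chosen normal form canonical; its compatibility with conversion,
abstraction and permutations follows from here. -/
theorem nf_eq_of_long {a : Ty B} {t : ATm N B C} {n : Tm N B C} (hn : Tm.Long ct n a)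
    (h : Conv ct [] a t n.toATm) : nf ct t = n.toATm := by
  obtain ⟨m, hm, hm', hc⟩ := nf_spec h.hasType.1
  rw [← hm'] at hc ⊢
  exact hm.toATm_eq hn (hc.symm.trans h)

theorem nf_eq_of_conv {a : Ty B} {t u : ATm N B C} (h : Conv ct [] a t u) :
    nf ct t = nf ct u := by
  obtain ⟨m, hm, hm', hc⟩ := nf_spec h.hasType.2
  rw [← hm'] at hc ⊢
  exact nf_eq_of_long hm (h.trans hc)

theorem nf_lam_abstr {a : Ty B} {t : ATm N B C} (h : HasType ct [] t a) (x : Var N B) :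
    nf ct (.lam x.type (abstr x 0 t)) = .lam x.type (abstr x 0 (nf ct t)) := by
  obtain ⟨m, hm, hm', hc⟩ := nf_spec h
  rw [← hm'] at hc ⊢
  exact nf_eq_of_long (n := .lam x m) (.lam hm) (hc.lam_abstr x)

theorem nf_perm {V : Set (Var N B)} {π : Equiv.Perm (Var N B)} (hπ : π ∈ varPerm V) {a : Ty B}
    {t : ATm N B C} (h : HasType ct [] t a) : nf ct (perm π t) = perm π (nf ct t) := by
  obtain ⟨m, hm, hm', hc⟩ := nf_spec h
  rw [← hm'] at hc ⊢
  rw [← Tm.toATm_perm hπ]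
  exact nf_eq_of_long (hm.perm hπ) (by rw [Tm.toATm_perm hπ]; exact hc.perm hπ)

/-- Normalization commutes with permutations. If `y` occurred in the normal form but not in the
term, swapping `y` with a fresh `z` would fix the term, hence the normal form, and `z` would occur
there. -/
theorem afv_nf_subset {a : Ty B} {t : ATm N B C} (h : HasType ct [] t a) :
    (nf ct t).afv ⊆ t.afv := by
  classical
  intro y hy
  by_contra hyt
  obtain ⟨z, hz, hz'⟩ := exists_fresh y.type (t.afv_finite.union (nf ct t).afv_finite)
  rw [Set.mem_union, not_or] at hz'
  have hπ : Equiv.swap y z ∈ varPerm Set.univ :=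
    varPerm.swap_mem (Set.mem_univ y) (Set.mem_univ z) hz.symm
  have e : perm (Equiv.swap y z) t = t := fsubst_eq_self fun x hx => by
    rw [Equiv.swap_apply_of_ne_of_ne]
    · rintro rfl; exact hyt hx
    · rintro rfl; exact hz'.1 hx
  have := nf_perm hπ h
  rw [e] at this
  apply hz'.2
  rw [this, mem_afv_perm]
  exact ⟨y, hy, by simp⟩

end ATm

namespace Tm

variable [Infinite N] {ct : C → Ty B}

theorem IsVar.fv_subset {t : Tm N B C} {x : Var N B} (h : IsVar ct t x)
    (ht : Long ct t x.type) : t.fv ⊆ {x} := by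
  rw [← afv_toATm, ← ATm.nf_eq_of_long ht h.symm]
  exact ATm.afv_nf_subset (.fvar x)

end Tm

end HOPattern

-- Patterns over a fixed set of bound variables, closed under permutation.

namespace HOPattern

variable {N B C : Type*}

theorem exists_forall₂ {α β : Type*} {R : α → β → Prop} {l : List β} (h : ∀ y ∈ l, ∃ x, R x y) :
    ∃ l', List.Forall₂ R l' l := by
  induction l with
  | nil => exact ⟨[], .nil⟩
  | cons y l ih =>
    rw [List.forall_mem_cons] at h
    obtain ⟨x, hx⟩ := h.1
    obtain ⟨l', hl⟩ := ih h.2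
    exact ⟨x :: l', .cons hx hl⟩

theorem forall₂_mem_left {α β : Type*} {R : α → β → Prop} {l : List α} {l' : List β}
    (h : List.Forall₂ R l l') {x : α} (hx : x ∈ l) : ∃ y ∈ l', R x y := by
  induction h with
  | nil => simp at hx
  | cons h _ ih => rcases List.mem_cons.1 hx with rfl | hx
                   · exact ⟨_, List.mem_cons_self, h⟩
                   · obtain ⟨y, hy, hr⟩ := ih hx
                     exact ⟨y, List.mem_cons_of_mem _ hy, hr⟩

theorem forall₂_mem_right {α β : Type*} {R : α → β → Prop} {l : List α} {l' : List β}
    (h : List.Forall₂ R l l') {y : β} (hy : y ∈ l') : ∃ x ∈ l, R x y :=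
  forall₂_mem_left h.flip hy

namespace Tm

variable {ct : C → Ty B} {V Q : Set (Var N B)}

/-- `t` is an eta-long form of `x` with all bound variables in `V`. -/
def IsEta (ct : C → Ty B) (V : Set (Var N B)) (t : Tm N B C) (x : Var N B) : Prop :=
  Long ct t x.type ∧ t.bv ⊆ V ∧ IsVar ct t x

theorem IsEta.perm {π : Equiv.Perm (Var N B)} (hπ : π ∈ varPerm V) {t : Tm N B C} {x : Var N B}
    (h : IsEta ct V t x) : IsEta ct V (t.perm π) (π x) := by
  refine ⟨?_, ?_, h.2.2.perm hπ⟩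
  · rw [varPerm.type_eq hπ]; exact h.1.perm hπ
  · intro y hy
    obtain ⟨x, hx, rfl⟩ := mem_bv_perm.1 hy
    exact varPerm.apply_mem hπ (h.2.1 hx)

theorem forall₂_isEta_perm {π : Equiv.Perm (Var N B)} (hπ : π ∈ varPerm V) {ts : List (Tm N B C)}
    {xs : List (Var N B)} (h : List.Forall₂ (IsEta ct V) ts xs) :
    List.Forall₂ (IsEta ct V) (ts.map (perm π)) (xs.map π) := by
  induction h with
  | nil => exact .nil
  | cons h _ ih => exact .cons (h.perm hπ) ih

theorem IsEta.mem_fv [Infinite N] {t : Tm N B C} {x y : Var N B} (h : IsEta ct V t x)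
    (hy : y ∈ t.fv) : y = x := h.2.2.fv_subset h.1 hy

theorem map_toATm_eq_of_isEta [Infinite N] {ts us : List (Tm N B C)} {xs : List (Var N B)}
    (h : List.Forall₂ (IsEta ct V) ts xs) (h' : List.Forall₂ (IsEta ct V) us xs) :
    ts.map toATm = us.map toATm := by
  induction h generalizing us with
  | nil => cases h'; rfl
  | cons h _ ih => cases h' with
    | cons h₁ h₂ =>
      simp only [List.map_cons]
      rw [ih h₂, h.1.toATm_eq h₁.1 (h.2.2.trans h₁.2.2.symm)]

theorem HasType.apps {h : Tm N B C} {ts : List (Tm N B C)} {tys : List (Ty B)} {a : Ty B}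
    (hh : HasType ct h (Ty.arrs tys a)) (hts : List.Forall₂ (HasType ct) ts tys) :
    HasType ct (apps h ts) a := by
  induction hts generalizing h with
  | nil => exact hh
  | cons h' _ ih => exact ih (.app hh h')

theorem Spine.apps {h : Tm N B C} {ts : List (Tm N B C)} {tys : List (Ty B)} {a : Ty B}
    (hh : Spine ct h (Ty.arrs tys a)) (hts : List.Forall₂ (Long ct) ts tys) :
    Spine ct (apps h ts) a := by
  induction hts generalizing h with
  | nil => exact hh
  | cons h' _ ih => exact ih (.app hh h')

theorem forall₂_long_of_isEta {ts : List (Tm N B C)} {xs : List (Var N B)}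
    (h : List.Forall₂ (IsEta ct V) ts xs) : List.Forall₂ (Long ct) ts (xs.map Var.type) := by
  induction h with
  | nil => exact .nil
  | cons h _ ih => exact .cons h.1 ih

/-- `X(t₁, …, tₘ)` with `X` in `Q` and the `tᵢ` eta-long forms of distinct variables `xs` of `V`. -/
structure FlexAt (ct : C → Ty B) (V Q : Set (Var N B)) (X : Var N B) (xs : List (Var N B))
    (ts : List (Tm N B C)) (b : B) : Prop where
  head_mem : X ∈ Q
  nodup : xs.Nodup
  mem : ∀ x ∈ xs, x ∈ V
  isEta : List.Forall₂ (IsEta ct V) ts xs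
  type_eq : X.type = Ty.arrs (xs.map Var.type) (.base b)

/-- Flexible patterns of basic type. -/
def Flex (ct : C → Ty B) (V Q : Set (Var N B)) (t : Tm N B C) (b : B) : Prop :=
  ∃ X xs ts, FlexAt ct V Q X xs ts b ∧ t = apps (.var X) ts

/-- Patterns in eta-long beta-normal form with bound variables in `V`, visible or not, and with
free variables in `Q`. The flag `true` marks rigid spines. -/
inductive Pat (ct : C → Ty B) (V Q : Set (Var N B)) : Bool → Tm N B C → Ty B → Prop
  | lam {x : Var N B} {t : Tm N B C} {b : Ty B} :
      x ∈ V → Pat ct V Q false t b → Pat ct V Q false (.lam x t) (.arr x.type b)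
  | flex {t : Tm N B C} {b : B} : Flex ct V Q t b → Pat ct V Q false t (.base b)
  | rigid {t : Tm N B C} {b : B} : Pat ct V Q true t (.base b) → Pat ct V Q false t (.base b)
  | const (c : C) : Pat ct V Q true (.const c) (ct c)
  -- No enclosing binder is required: every variable of `V` counts as bound. Open bodies of patterns
  -- are thus patterns, and permutations of `V` act on them.
  | var {x : Var N B} : x ∈ V → Pat ct V Q true (.var x) x.type
  | app {t u : Tm N B C} {a b : Ty B} :
      Pat ct V Q true t (.arr a b) → Pat ct V Q false u a → Pat ct V Q true (.app t u) b

theorem FlexAt.perm {π : Equiv.Perm (Var N B)} (hπ : π ∈ varPerm V)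
    {X : Var N B} {xs : List (Var N B)} {ts : List (Tm N B C)} {b : B}
    (h : FlexAt ct V Q X xs ts b) : FlexAt ct V Q X (xs.map π) (ts.map (Tm.perm π)) b where
  head_mem := h.head_mem
  nodup := h.nodup.map π.injective
  mem y hy := by
    obtain ⟨x, hx, rfl⟩ := List.mem_map.1 hy
    exact varPerm.apply_mem hπ (h.mem x hx)
  isEta := forall₂_isEta_perm hπ h.isEta
  type_eq := by
    rw [h.type_eq, List.map_map]
    congr 1
    exact List.map_congr_left fun x _ => (varPerm.type_eq hπ x).symm

theorem perm_var_of_mem (hQ : Disjoint Q V) {π : Equiv.Perm (Var N B)} (hπ : π ∈ varPerm V)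
    {X : Var N B} (hX : X ∈ Q) : π X = X := hπ.2 X (Set.disjoint_left.1 hQ hX)

theorem Flex.perm (hQ : Disjoint Q V) {π : Equiv.Perm (Var N B)} (hπ : π ∈ varPerm V)
    {t : Tm N B C} {b : B} (h : Flex ct V Q t b) : Flex ct V Q (t.perm π) b := by
  obtain ⟨X, xs, ts, h, rfl⟩ := h
  refine ⟨X, _, _, h.perm hπ, ?_⟩
  rw [perm_apps, Tm.perm, perm_var_of_mem hQ hπ h.head_mem]

theorem Pat.perm (hQ : Disjoint Q V) {π : Equiv.Perm (Var N B)} (hπ : π ∈ varPerm V)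
    {β : Bool} {t : Tm N B C} {a : Ty B} (h : Pat ct V Q β t a) : Pat ct V Q β (t.perm π) a := by
  induction h with
  | @lam x t b hx _ ih =>
    rw [← varPerm.type_eq hπ x]; exact .lam (varPerm.apply_mem hπ hx) ih
  | flex h => exact .flex (h.perm hQ hπ)
  | rigid _ ih => exact .rigid ih
  | const c => exact .const c
  | @var x hx => rw [← varPerm.type_eq hπ x]; exact .var (varPerm.apply_mem hπ hx)
  | app _ _ ih₁ ih₂ => exact .app ih₁ ih₂

theorem Flex.hasType {t : Tm N B C} {b : B} (h : Flex ct V Q t b) :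
    HasType ct t (.base b) := by
  obtain ⟨X, xs, ts, h, rfl⟩ := h
  refine .apps (tys := xs.map Var.type) ?_ ((forall₂_long_of_isEta h.isEta).imp
    fun _ _ h => h.hasType)
  rw [← h.type_eq]
  exact .var X

theorem Pat.hasType {β : Bool} {t : Tm N B C} {a : Ty B} (h : Pat ct V Q β t a) :
    HasType ct t a := by
  induction h with
  | lam _ _ ih => exact .lam ih
  | flex h => exact h.hasType
  | rigid _ ih => exact ih
  | const c => exact .const c
  | var hx => exact .var _
  | app _ _ ih₁ ih₂ => exact .app ih₁ ih₂

theorem FlexAt.mem_fv [Infinite N] {X : Var N B} {xs : List (Var N B)} {ts : List (Tm N B C)}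
    {b : B} (h : FlexAt ct V Q X xs ts b) {y : Var N B} (hy : y ∈ (apps (.var X) ts).fv) :
    y = X ∨ y ∈ xs := by
  rcases mem_fv_apps.1 hy with hy | ⟨t, ht, hy⟩
  · exact Or.inl hy
  · obtain ⟨x, hx, he⟩ := forall₂_mem_left h.isEta ht
    rw [he.mem_fv hy]
    exact Or.inr hx

theorem Pat.fv_subset [Infinite N] {β : Bool} {t : Tm N B C} {a : Ty B} (h : Pat ct V Q β t a) :
    t.fv ⊆ V ∪ Q := by
  induction h with
  | lam _ _ ih => exact Set.sdiff_subset.trans ih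
  | flex h =>
    obtain ⟨X, xs, ts, h, rfl⟩ := h
    intro y hy
    rcases h.mem_fv hy with rfl | hy
    · exact Or.inr h.head_mem
    · exact Or.inl (h.mem y hy)
  | rigid _ ih => exact ih
  | const c => exact Set.empty_subset _
  | var hx => exact Set.singleton_subset_iff.2 (Or.inl hx)
  | app _ _ ih₁ ih₂ => exact Set.union_subset ih₁ ih₂

/-- A free variable of a pattern that lies in `Q` heads a flexible subterm. -/
theorem Pat.exists_flexAt [Infinite N] (hQ : Disjoint Q V) {β : Bool} {t : Tm N B C} {a : Ty B}
    (h : Pat ct V Q β t a) {X : Var N B} (hX : X ∈ Q) (hXt : X ∈ t.fv) :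
    ∃ xs ts b, FlexAt ct V Q X xs ts b := by
  induction h with
  | lam _ _ ih => exact ih hXt.1
  | flex h =>
    obtain ⟨Y, xs, ts, h, rfl⟩ := h
    rcases h.mem_fv hXt with rfl | hX'
    · exact ⟨xs, ts, _, h⟩
    · exact absurd (h.mem X hX') (Set.disjoint_left.1 hQ hX)
  | rigid _ ih => exact ih hXt
  | const c => cases hXt
  | @var x hx =>
    obtain rfl : X = x := hXt
    exact absurd hx (Set.disjoint_left.1 hQ hX)
  | app _ _ ih₁ ih₂ => exact hXt.elim ih₁ ih₂

theorem Spine.of_apps {h : Tm N B C} {ts : List (Tm N B C)} {a : Ty B}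
    (hs : Spine ct (Tm.apps h ts) a) :
    ∃ tys, Spine ct h (Ty.arrs tys a) ∧ List.Forall₂ (Long ct) ts tys := by
  induction ts generalizing h with
  | nil => exact ⟨[], hs, .nil⟩
  | cons t ts ih =>
    obtain ⟨tys, h₁, h₂⟩ := ih (h := .app h t) hs
    cases h₁ with
    | app h₃ h₄ => exact ⟨_ :: tys, h₃, .cons h₄ h₂⟩

theorem Pat.apps {h : Tm N B C} {ts : List (Tm N B C)} {tys : List (Ty B)} {a : Ty B}
    (hh : Pat ct V Q true h (Ty.arrs tys a)) (hts : List.Forall₂ (Pat ct V Q false) ts tys) :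
    Pat ct V Q true (apps h ts) a := by
  induction hts generalizing h with
  | nil => exact hh
  | cons h' _ ih => exact ih (.app hh h')

theorem Long.spine_of_apps {h : Tm N B C} {ts : List (Tm N B C)} {a : Ty B}
    (hl : Long ct (apps h ts) a) (hh : ∀ x t, h ≠ .lam x t) :
    ∃ b, a = .base b ∧ Spine ct (apps h ts) (.base b) := by
  generalize he : apps h ts = t at hl
  cases hl with
  | lam hl =>
    exfalso
    induction ts generalizing h with
    | nil => exact hh _ _ he
    | cons t ts ih => exact ih (h := .app h t) (by simp) he
  | spine hl => exact ⟨_, rfl, he ▸ hl⟩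

theorem forall₂_of_forall₂_of_forall {α β : Type*} {R S : α → β → Prop} {l : List α} {l' : List β}
    (h : List.Forall₂ R l l') (h' : ∀ x ∈ l, ∀ y ∈ l', R x y → S x y) : List.Forall₂ S l l' := by
  induction h with
  | nil => exact .nil
  | cons h _ ih =>
    exact .cons (h' _ List.mem_cons_self _ List.mem_cons_self h) (ih fun x hx y hy =>
      h' x (List.mem_cons_of_mem _ hx) y (List.mem_cons_of_mem _ hy))

/-- Uniqueness of types identifies the argument types of the head with the types of the variables
that the arguments represent. -/
theorem forall₂_var_type {ts : List (Tm N B C)} {xs : List (Var N B)} {tys : List (Ty B)}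
    (h : List.Forall₂ (IsVar ct) ts xs) (h' : List.Forall₂ (Long ct) ts tys)
    (hb : ∀ t ∈ ts, t.bv ⊆ V) :
    xs.map Var.type = tys ∧ List.Forall₂ (IsEta ct V) ts xs := by
  induction h generalizing tys with
  | nil => cases h'; exact ⟨rfl, .nil⟩
  | cons h _ ih => cases h' with
    | cons h₁ h₂ =>
      rw [List.forall_mem_cons] at hb
      obtain ⟨rfl, h₃⟩ := ih h₂ hb.2
      obtain rfl := h.hasType.1.unique h₁.hasType.toATm
      exact ⟨rfl, .cons ⟨h₁, hb.1, h⟩ h₃⟩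

/-- Scoping is forgotten: the set `W` of enclosing binders is enlarged to `V`, and a free head
outside `W` must then belong to `Q`. -/
theorem IsPattern.pat {W : Set (Var N B)} {t : Tm N B C} (h : IsPattern ct W t) {a : Ty B}
    (hl : Long ct t a) (hW : W ⊆ V) (hb : t.bv ⊆ V) (hf : t.fv ⊆ W ∪ Q) :
    Pat ct V Q false t a := by
  induction h generalizing a with
  | @lam W x t _ ih =>
    cases hl with
    | lam hl =>
      have hx : x ∈ V := hb (Set.mem_insert _ _)
      refine .lam hx (ih hl (Set.insert_subset hx hW)
        (fun y hy => hb (Set.mem_insert_of_mem _ hy)) fun y hy => ?_)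
      by_cases hyx : y = x
      · exact Or.inl (Or.inl hyx)
      · exact (hf ⟨hy, hyx⟩).imp Or.inr id
    | spine hl => cases hl
  | const c h ih =>
    obtain ⟨b, rfl, hs⟩ := hl.spine_of_apps (by simp)
    obtain ⟨tys, h₁, h₂⟩ := hs.of_apps
    refine .rigid (.apps (tys := tys) ?_ (forall₂_of_forall₂_of_forall h₂
      fun t ht _ _ hl => ih t ht hl hW (fun y hy => hb (mem_bv_apps.2 (Or.inr ⟨t, ht, hy⟩)))
        fun y hy => hf (mem_fv_apps.2 (Or.inr ⟨t, ht, hy⟩))))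
    generalize Ty.arrs tys (.base b) = a at h₁
    cases h₁
    exact .const c
  | @bound W x ts hx h ih =>
    obtain ⟨b, rfl, hs⟩ := hl.spine_of_apps (by simp)
    obtain ⟨tys, h₁, h₂⟩ := hs.of_apps
    refine .rigid (.apps (tys := tys) ?_ (forall₂_of_forall₂_of_forall h₂
      fun t ht _ _ hl => ih t ht hl hW (fun y hy => hb (mem_bv_apps.2 (Or.inr ⟨t, ht, hy⟩)))
        fun y hy => hf (mem_fv_apps.2 (Or.inr ⟨t, ht, hy⟩))))
    generalize Ty.arrs tys (.base b) = a at h₁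
    cases h₁
    exact .var (hW hx)
  | @free W X ts xs hX hn hm h =>
    obtain ⟨b, rfl, hs⟩ := hl.spine_of_apps (by simp)
    obtain ⟨tys, h₁, h₂⟩ := hs.of_apps
    obtain ⟨rfl, h₃⟩ := forall₂_var_type (V := V) h h₂
      fun t ht y hy => hb (mem_bv_apps.2 (Or.inr ⟨t, ht, hy⟩))
    refine .flex ⟨X, xs, ts, ⟨?_, hn, fun x hx => hW (hm x hx), h₃, ?_⟩, rfl⟩
    · exact (hf (mem_fv_apps.2 (Or.inl rfl))).resolve_left hX
    · generalize Ty.arrs (xs.map Var.type) (.base b) = a at h₁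
      cases h₁
      rfl

end Tm

end HOPattern

-- Values of patterns under substitutions that avoid the bound variables.

namespace HOPattern

open Tm ATm

variable {N B C : Type*}

/-- A substitution whose values do not contain the variables of `V`. -/
structure ClosedSubst (ct : C → Ty B) (V Q : Set (Var N B)) where
  val : Var N B → ATm N B C
  typed : ∀ x, ATm.HasType ct [] (val x) x.type
  fix : ∀ x ∈ V, val x = .fvar x
  fresh : ∀ X ∈ Q, ∀ y ∈ (val X).afv, y ∉ V

theorem Tm.Pat.hasType_fsubst {ct : C → Ty B} {V Q : Set (Var N B)} (S : ClosedSubst ct V Q)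
    {β : Bool} {t : Tm N B C} {a : Ty B} (h : Pat ct V Q β t a) :
    ATm.HasType ct [] (fsubst S.val t.toATm) a := h.hasType.toATm.fsubst S.typed

/-- Instantiating the new index with `x` inverts the abstraction, since a closed term has no other
loose index. -/
theorem abstr_injective {x : Var N B} {t u : ATm N B C} (ht : Closed 0 t) (hu : Closed 0 u)
    (h : abstr x 0 t = abstr x 0 u) : t = u := by
  have key : ∀ t : ATm N B C, Closed 0 t → inst (.fvar x) (abstr x 0 t) = t := fun t ht => by
    have := inst_fsubst_abstr (s := .fvar) (fun _ => trivial) (x := x) (u := .fvar x) trivial ht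
    rw [fsubst_fvar] at this
    rw [this]
    refine fsubst_eq_self fun y _ => ?_
    by_cases h : y = x
    · subst h; simp
    · rw [upd_of_ne _ _ h]
  rw [← key t ht, h, key u hu]

section Value

variable [Infinite N] {ct : C → Ty B} {V Q : Set (Var N B)}

/-- `value ct s true t` is the spine `s(t)` for a rigid spine `t`, with normalized arguments, and
`value ct s false t` is the eta-long beta-normal form of `s(t)`. -/
noncomputable def value (ct : C → Ty B) (s : Var N B → ATm N B C) : Bool → Tm N B C → ATm N B C
  | true, .app t u => .app (value ct s true t) (nf ct (fsubst s u.toATm))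
  | true, t => t.toATm
  | false, t => nf ct (fsubst s t.toATm)

theorem value_false (s : Var N B → ATm N B C) (t : Tm N B C) :
    value ct s false t = nf ct (fsubst s t.toATm) := by rw [value]

variable (S : ClosedSubst ct V Q)

theorem mem_afv_fsubst_toATm {β : Bool} {t : Tm N B C} {a : Ty B} (h : Pat ct V Q β t a)
    {y : Var N B} (hy : y ∈ V) (hyt : y ∈ (fsubst S.val t.toATm).afv) : y ∈ t.fv := by
  obtain ⟨x, hx, hyx⟩ := mem_afv_fsubst.1 hyt
  rw [afv_toATm] at hx
  rcases h.fv_subset hx with hxV | hxQ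
  · rw [S.fix x hxV] at hyx
    exact (show y = x from hyx) ▸ hx
  · exact absurd hy (S.fresh x hxQ y hyx)

/-- The substitution fixes the variables of `V`, and its values on `Q` do not contain them, so
permuting `V` before or after it is the same. -/
theorem fsubst_perm (hQ : Disjoint Q V) {π : Equiv.Perm (Var N B)} (hπ : π ∈ varPerm V)
    {β : Bool} {t : Tm N B C} {a : Ty B} (h : Pat ct V Q β t a) :
    fsubst S.val (t.perm π).toATm = ATm.perm π (fsubst S.val t.toATm) := by
  rw [toATm_perm hπ, ATm.perm, ATm.perm, fsubst_fsubst, fsubst_fsubst]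
  refine fsubst_congr fun x hx => ?_
  rw [afv_toATm] at hx
  rcases h.fv_subset hx with hxV | hxQ
  · rw [S.fix x hxV]
    simp only [fsubst]
    rw [S.fix _ (varPerm.apply_mem hπ hxV)]
  · simp only [fsubst]
    rw [perm_var_of_mem hQ hπ hxQ]
    exact (fsubst_eq_self fun y hy => by rw [hπ.2 y (S.fresh x hxQ y hy)]).symm

/-- The head is a constant or a variable of `V`, which the substitution fixes; no redex arises at
the head, and only the arguments need normalizing. -/
theorem Tm.Pat.exists_spine {β : Bool} {t : Tm N B C} {a : Ty B} (h : Pat ct V Q β t a)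
    (hβ : β = true) : ∃ n : Tm N B C, Spine ct n a ∧ n.toATm = value ct S.val true t ∧
      ATm.Conv ct [] a (fsubst S.val t.toATm) n.toATm := by
  induction h with
  | lam | flex | rigid => cases hβ
  | const c => exact ⟨.const c, .const c, rfl, .refl (.const c)⟩
  | @var x hx =>
    refine ⟨.var x, .var x, rfl, ?_⟩
    simp only [toATm, fsubst]
    rw [S.fix x hx]
    exact .refl (.fvar x)
  | app _ h₂ ih₁ _ =>
    obtain ⟨n, hn, hn', hc⟩ := ih₁ rfl
    obtain ⟨m, hm, hm', hc'⟩ := nf_spec (h₂.hasType_fsubst S)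
    refine ⟨.app n m, .app hn hm, ?_, ?_⟩
    · simp only [toATm, value]; rw [hn', hm']
    · rw [← hm'] at hc'; exact hc.app hc'

theorem Tm.Pat.value_eq {t : Tm N B C} {b : B} (h : Pat ct V Q true t (.base b)) :
    value ct S.val false t = value ct S.val true t := by
  obtain ⟨n, hn, hn', hc⟩ := h.exists_spine S rfl
  rw [← hn', value]
  exact nf_eq_of_long (.spine hn) hc

theorem Tm.Pat.hasType_value {β : Bool} {t : Tm N B C} {a : Ty B} (h : Pat ct V Q β t a) :
    ATm.HasType ct [] (value ct S.val β t) a := by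
  cases β with
  | false => rw [value_false]; exact (conv_nf (h.hasType_fsubst S)).hasType.2
  | true =>
    obtain ⟨n, _, hn, hc⟩ := h.exists_spine S rfl
    rw [← hn]; exact hc.hasType.2

theorem Tm.Pat.conv_value {t : Tm N B C} {a : Ty B} (h : Pat ct V Q false t a) :
    ATm.Conv ct [] a (fsubst S.val t.toATm) (value ct S.val false t) := by
  rw [value_false]; exact conv_nf (h.hasType_fsubst S)

theorem Tm.Pat.value_perm (hQ : Disjoint Q V) {π : Equiv.Perm (Var N B)} (hπ : π ∈ varPerm V)
    {β : Bool} {t : Tm N B C} {a : Ty B} (h : Pat ct V Q β t a) :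
    value ct S.val β (t.perm π) = ATm.perm π (value ct S.val β t) := by
  have key : ∀ {β : Bool} {t : Tm N B C} {a : Ty B}, Pat ct V Q β t a →
      value ct S.val false (t.perm π) = ATm.perm π (value ct S.val false t) := fun h => by
    simp only [value]
    rw [fsubst_perm S hQ hπ h, nf_perm hπ (h.hasType_fsubst S)]
  cases β with
  | false => exact key h
  | true =>
    generalize hβ : true = β at h
    induction h with
    | lam | flex | rigid => cases hβ
    | const c => rfl
    | var hx => rfl
    | app _ h₂ ih₁ _ =>
      simp only [value, Tm.perm]
      rw [ih₁ rfl, ← value_false, ← value_false, key h₂]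
      rfl

theorem Tm.Pat.mem_afv_value {t : Tm N B C} {a : Ty B} (h : Pat ct V Q false t a) {y : Var N B}
    (hy : y ∈ V) (hyt : y ∈ (value ct S.val false t).afv) : y ∈ t.fv := by
  rw [value_false] at hyt
  exact mem_afv_fsubst_toATm S h hy (afv_nf_subset (h.hasType_fsubst S) hyt)

/-- The substituted values avoid `V`, so no binder has to be renamed. All members of a family thus
share the binder `x`, and it can serve in the generalization. -/
theorem Tm.Pat.value_lam {x : Var N B} {t : Tm N B C} {a : Ty B} (hx : x ∈ V)
    (h : Pat ct V Q false t a) : value ct S.val false (.lam x t) =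
      .lam x.type (abstr x 0 (value ct S.val false t)) := by
  have e : fsubst S.val (Tm.lam x t).toATm =
      .lam x.type (abstr x 0 (fsubst S.val t.toATm)) := by
    simp only [toATm, fsubst]
    rw [fsubst_abstr_self 0 _ (S.fix x hx)]
    intro z hz hzx hxz
    rw [afv_toATm] at hz
    rcases h.fv_subset hz with hzV | hzQ
    · rw [S.fix z hzV] at hxz
      exact hzx (show x = z from hxz).symm
    · exact S.fresh z hzQ x hxz hx
  simp only [value]
  rw [e, nf_lam_abstr (h.hasType_fsubst S)]

end Value

-- Families modulo permutations and their supports.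

/-- Families of terms up to the permutations of the variables in `V`. -/
def famSetoid (V : Set (Var N B)) (C I : Type*) : Setoid (I → ATm N B C) where
  r F G := ∃ π ∈ varPerm V, G = fun i => ATm.perm π (F i)
  iseqv :=
    { refl := fun F => ⟨1, one_mem _, funext fun i => (ATm.perm_one _).symm⟩
      symm := by
        rintro F _ ⟨π, hπ, rfl⟩
        exact ⟨π⁻¹, inv_mem hπ, funext fun i => by
          rw [← ATm.perm_mul, inv_mul_cancel, ATm.perm_one]⟩
      trans := by
        rintro F _ _ ⟨π, hπ, rfl⟩ ⟨ρ, hρ, rfl⟩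
        exact ⟨ρ * π, mul_mem hρ hπ, funext fun i => by rw [ATm.perm_mul]⟩ }

section Rep

variable {I : Type*} {V : Set (Var N B)}

/-- A representative of the class of a family. -/
noncomputable def rep (V : Set (Var N B)) (F : I → ATm N B C) : I → ATm N B C :=
  (Quotient.mk (famSetoid V C I) F).out

theorem exists_eq_perm_rep (F : I → ATm N B C) :
    ∃ π ∈ varPerm V, F = fun i => ATm.perm π (rep V F i) :=
  Quotient.mk_out (s := famSetoid V C I) F

theorem rep_perm {π : Equiv.Perm (Var N B)} (hπ : π ∈ varPerm V) (F : I → ATm N B C) :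
    rep V (fun i => ATm.perm π (F i)) = rep V F := by
  unfold rep
  congr 1
  exact Quotient.sound (s := famSetoid V C I) ((famSetoid V C I).symm ⟨π, hπ, rfl⟩)

open Classical in
/-- The variables that occur in a family, in the order of `vs`. -/
noncomputable def support (vs : List (Var N B)) (F : I → ATm N B C) : List (Var N B) :=
  vs.filter fun x => ∃ i, x ∈ (F i).afv

theorem mem_support {vs : List (Var N B)} {F : I → ATm N B C} {x : Var N B} :
    x ∈ support vs F ↔ x ∈ vs ∧ ∃ i, x ∈ (F i).afv := by
  simp [support]

end Rep

-- The generalization relation, its equivariance and its uniqueness.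

section Gen

variable [Infinite N] {ct : C → Ty B} {V Q : Set (Var N B)} {I : Type*}
  (S : I → ClosedSubst ct V Q) (vs : List (Var N B)) (ν : (I → ATm N B C) × B → N)

/-- The fresh variable for a class of flexible families. -/
noncomputable def freshVar (p : (I → ATm N B C) × B) : Var N B :=
  ⟨ν p, Ty.arrs ((support vs p.1).map Var.type) (.base p.2)⟩

/-- The family of values of a term. -/
noncomputable def values (β : Bool) (t : Tm N B C) (i : I) : ATm N B C := value ct (S i).val β t

/-- The family of the values of a rigid pattern. -/
def IsRigid (F : I → ATm N B C) : Prop :=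
  ∃ t b, Pat ct V Q true t (.base b) ∧ F = values S true t

/-- `Gen β a F g`: the named term `g` is the least general generalization of the family `F`. -/
inductive Gen : Bool → Ty B → (I → ATm N B C) → Tm N B C → Prop
  | lam {x : Var N B} {b : Ty B} {F : I → ATm N B C} {g : Tm N B C} : x ∈ V →
      Gen false b F g → Gen false (.arr x.type b) (fun i => .lam x.type (abstr x 0 (F i))) (.lam x g)
  | spine {b : B} {F : I → ATm N B C} {g : Tm N B C} : IsRigid S F → Gen true (.base b) F g →
      Gen false (.base b) F g
  -- The fresh variable depends only on the class of the family. The permutation `π` carries the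
  -- chosen representative to the actual family and so determines the arguments. Excluding rigid
  -- families makes this case disjoint from `spine`.
  | flex {b : B} {t : Tm N B C} {F : I → ATm N B C} {π : Equiv.Perm (Var N B)}
      {es : List (Tm N B C)} : Flex ct V Q t b → F = values S false t → ¬ IsRigid S F →
      π ∈ varPerm V → (F = fun i => ATm.perm π (rep V F i)) →
      List.Forall₂ (IsEta ct V) es ((support vs (rep V F)).map π) →
      Gen false (.base b) F (apps (.var (freshVar vs ν (rep V F, b))) es)
  | const (c : C) : Gen true (ct c) (fun _ => .const c) (.const c)
  | var {x : Var N B} : x ∈ V → Gen true x.type (fun _ => .fvar x) (.var x)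
  | app {a b : Ty B} {F F' : I → ATm N B C} {g g' : Tm N B C} : Gen true (.arr a b) F g →
      Gen false a F' g' → Gen true b (fun i => .app (F i) (F' i)) (.app g g')

variable {S vs ν}

theorem IsRigid.perm (hQ : Disjoint Q V) {π : Equiv.Perm (Var N B)} (hπ : π ∈ varPerm V)
    {F : I → ATm N B C} (h : IsRigid S F) : IsRigid S fun i => ATm.perm π (F i) := by
  obtain ⟨t, b, ht, rfl⟩ := h
  exact ⟨t.perm π, b, ht.perm hQ hπ, funext fun i => (Pat.value_perm (S i) hQ hπ ht).symm⟩

theorem isRigid_perm_iff (hQ : Disjoint Q V) {π : Equiv.Perm (Var N B)} (hπ : π ∈ varPerm V)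
    {F : I → ATm N B C} : IsRigid S (fun i => ATm.perm π (F i)) ↔ IsRigid S F := by
  refine ⟨fun h => ?_, fun h => h.perm hQ hπ⟩
  have := h.perm hQ (inv_mem hπ)
  simpa only [← ATm.perm_mul, inv_mul_cancel, ATm.perm_one] using this

theorem Gen.hasType {β : Bool} {a : Ty B} {F : I → ATm N B C} {g : Tm N B C}
    (h : Gen S vs ν β a F g) (i : I) : ATm.HasType ct [] (F i) a := by
  induction h with
  | lam _ _ ih => exact ih.lam_abstr
  | spine _ _ ih => exact ih
  | flex h hF => rw [hF]; exact Pat.hasType_value (S i) (.flex h)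
  | const c => exact .const c
  | var => exact .fvar _
  | app _ _ ih₁ ih₂ => exact .app ih₁ ih₂

/-- A permutation preserves rigidity and the class of a family, and `hfresh` keeps the fresh heads
outside `V`, where it acts trivially. Only the binders, the arguments and the rigid heads move. -/
theorem Gen.perm (hQ : Disjoint Q V) {ρ : Equiv.Perm (Var N B)} (hρ : ρ ∈ varPerm V)
    (hfresh : ∀ p, ∀ x ∈ V, x.name ≠ ν p) {β : Bool} {a : Ty B} {F : I → ATm N B C}
    {g : Tm N B C} (h : Gen S vs ν β a F g) :
    Gen S vs ν β a (fun i => ATm.perm ρ (F i)) (g.perm ρ) := by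
  induction h with
  | @lam x b F g hx _ ih =>
    have := Gen.lam (varPerm.apply_mem hρ hx) ih
    rw [varPerm.type_eq hρ] at this
    simp only [← ATm.perm_abstr] at this
    exact this
  | spine hr _ ih => exact .spine (hr.perm hQ hρ) ih
  | @flex b t F π es h hF hr hπ hFπ hes =>
    have hr' : rep V (fun i => ATm.perm ρ (F i)) = rep V F := rep_perm hρ F
    have := Gen.flex (S := S) (vs := vs) (ν := ν) (F := fun i => ATm.perm ρ (F i)) (π := ρ * π)
      (es := es.map (Tm.perm ρ)) (h.perm hQ hρ)
      (by rw [hF]; exact funext fun i => (Pat.value_perm (S i) hQ hρ (.flex h)).symm)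
      (by rwa [isRigid_perm_iff hQ hρ]) (mul_mem hρ hπ)
      (by rw [hr']; funext i; rw [ATm.perm_mul, ← congrFun hFπ i])
      (by
        rw [hr']
        have := forall₂_isEta_perm hρ hes
        rwa [List.map_map] at this)
    rw [hr'] at this
    rw [perm_apps, Tm.perm, hρ.2]
    · exact this
    · exact fun hV => hfresh _ _ hV rfl
  | const c => exact .const c
  | @var x hx =>
    rw [← varPerm.type_eq hρ x]
    exact .var (varPerm.apply_mem hρ hx)
  | app _ _ ih₁ ih₂ => exact .app ih₁ ih₂

/-- Generalizing adds no variable of `V`: leaves take only variables from the support of the family.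
Nonemptiness of the index set matters for a constant family `x`. -/
theorem Gen.mem_afv [Nonempty I] (hfresh : ∀ p, ∀ x ∈ V, x.name ≠ ν p) {β : Bool} {a : Ty B}
    {F : I → ATm N B C} {g : Tm N B C} (h : Gen S vs ν β a F g) {x : Var N B} (hx : x ∈ V)
    (hxg : x ∈ g.fv) : ∃ i, x ∈ (F i).afv := by
  induction h with
  | @lam y b F g hy _ ih =>
    obtain ⟨i, hi⟩ := ih hxg.1
    refine ⟨i, ?_⟩
    simp only [afv, afv_abstr]
    exact ⟨hi, hxg.2⟩
  | spine _ _ ih => exact ih hxg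
  | @flex b t F π es _ _ _ hπ hFπ hes =>
    rcases mem_fv_apps.1 hxg with hx' | ⟨e, he, hx'⟩
    · obtain rfl : x = _ := hx'
      exact absurd rfl (hfresh _ _ hx)
    · obtain ⟨y, hy, hye⟩ := forall₂_mem_left hes he
      obtain rfl := hye.mem_fv hx'
      obtain ⟨z, hz, rfl⟩ := List.mem_map.1 hy
      obtain ⟨-, i, hi⟩ := mem_support.1 hz
      refine ⟨i, ?_⟩
      rw [hFπ]
      exact mem_afv_perm.2 ⟨z, hi, rfl⟩
  | const c => cases hxg
  | var => exact ⟨‹Nonempty I›.some, hxg⟩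
  | app _ _ ih₁ ih₂ =>
    rcases hxg with h | h
    · obtain ⟨i, hi⟩ := ih₁ h; exact ⟨i, Or.inl hi⟩
    · obtain ⟨i, hi⟩ := ih₂ h; exact ⟨i, Or.inr hi⟩

theorem Gen.bv_subset {β : Bool} {a : Ty B} {F : I → ATm N B C} {g : Tm N B C}
    (h : Gen S vs ν β a F g) : g.bv ⊆ V := by
  induction h with
  | lam hx _ ih => exact Set.insert_subset hx ih
  | spine _ _ ih => exact ih
  | flex _ _ _ _ _ hes =>
    intro y hy
    rcases mem_bv_apps.1 hy with hy | ⟨e, he, hy⟩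
    · cases hy
    · obtain ⟨x, -, hx⟩ := forall₂_mem_left hes he
      exact hx.2.1 hy
  | const c => exact Set.empty_subset _
  | var => exact Set.empty_subset _
  | app _ _ ih₁ ih₂ => exact Set.union_subset ih₁ ih₂

/-- The classes of flexible families. -/
def flexClasses (S : I → ClosedSubst ct V Q) : Set ((I → ATm N B C) × B) :=
  {p | ∃ t, Flex ct V Q t p.2 ∧ p.1 = rep V (values S false t)}

theorem Gen.fv_subset (hvs : ∀ x ∈ vs, x ∈ V) {β : Bool} {a : Ty B} {F : I → ATm N B C}
    {g : Tm N B C} (h : Gen S vs ν β a F g) : g.fv ⊆ V ∪ freshVar vs ν '' flexClasses S := by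
  induction h with
  | lam hx _ ih => exact Set.sdiff_subset.trans ih
  | spine _ _ ih => exact ih
  | @flex b t F π es h hF _ hπ _ hes =>
    intro y hy
    rcases mem_fv_apps.1 hy with hy | ⟨e, he, hy⟩
    · exact Or.inr ⟨_, ⟨t, h, by rw [hF]⟩, (show y = _ from hy).symm⟩
    · obtain ⟨x, hx, hxe⟩ := forall₂_mem_left hes he
      obtain rfl := hxe.mem_fv hy
      obtain ⟨z, hz, rfl⟩ := List.mem_map.1 hx
      exact Or.inl (varPerm.apply_mem hπ (hvs z (mem_support.1 hz).1))
  | const c => exact Set.empty_subset _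
  | var hx => exact Set.singleton_subset_iff.2 (Or.inl hx)
  | app _ _ ih₁ ih₂ => exact Set.union_subset ih₁ ih₂

theorem Gen.long_or_spine {β : Bool} {a : Ty B} {F : I → ATm N B C} {g : Tm N B C}
    (h : Gen S vs ν β a F g) : bif β then Spine ct g a else Long ct g a := by
  induction h with
  | lam _ _ ih => exact .lam ih
  | spine _ _ ih => exact .spine ih
  | @flex b t F π es _ _ _ hπ _ hes =>
    refine .spine (.apps (tys := ((support vs (rep V F)).map π).map Var.type) ?_
      (forall₂_long_of_isEta hes))
    rw [List.map_map, List.map_congr_left (f := Var.type ∘ π) (g := Var.type)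
      fun x _ => varPerm.type_eq hπ x]
    exact .var (freshVar vs ν (rep V F, b))
  | const c => exact .const c
  | var => exact .var _
  | app _ _ ih₁ ih₂ => exact .app ih₁ ih₂

theorem Gen.long {a : Ty B} {F : I → ATm N B C} {g : Tm N B C}
    (h : Gen S vs ν false a F g) : Long ct g a := h.long_or_spine

theorem Gen.hasType_right {β : Bool} {a : Ty B} {F : I → ATm N B C} {g : Tm N B C}
    (h : Gen S vs ν β a F g) : Tm.HasType ct g a := by
  have := h.long_or_spine
  cases β
  · exact Long.hasType this
  · exact Spine.hasType this

/-- The generalization of a family is unique up to alpha-equivalence. -/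
theorem Gen.toATm_eq [Nonempty I] (hQ : Disjoint Q V) (hfresh : ∀ p, ∀ x ∈ V, x.name ≠ ν p)
    {β : Bool} {a a' : Ty B} {F F' : I → ATm N B C} {g g' : Tm N B C} (h : Gen S vs ν β a F g)
    (h' : Gen S vs ν β a' F' g') (hF : F = F') : g.toATm = g'.toATm := by
  classical
  obtain ⟨i₀⟩ := ‹Nonempty I›
  have ha : a = a' := (h.hasType i₀).unique (hF ▸ h'.hasType i₀)
  induction h generalizing a' F' g' with
  | @lam x b F g hx h ih =>
    cases h' with
    | @lam y b' F' g' hy h' =>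
      have hF' := fun i => ATm.lam.inj (congrFun hF i)
      have hxy : x.type = y.type := (hF' i₀).1
      have hn : ∀ i, x ∉ (abstr y 0 (F' i)).afv := fun i => by
        rw [← (hF' i).2, afv_abstr]; exact fun h => h.2 rfl
      have hsw := varPerm.swap_mem hx hy hxy
      -- The two abstractions may use different binders `x` and `y`; swapping them makes the
      -- families of bodies equal, and equivariance moves the second generalization along.
      have e : F = fun i => ATm.perm (Equiv.swap x y) (F' i) := funext fun i =>
        abstr_injective (h.hasType i).closed ((h'.hasType i).perm hsw).closed
          ((hF' i).2.trans (abstr_swap (hn i)).symm)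
      have := ih (h'.perm hQ hsw hfresh) e (by injection ha)
      simp only [toATm]
      rw [this, hxy, toATm_perm hsw, abstr_swap]
      rw [afv_abstr, afv_toATm]
      rintro ⟨hxg, hne⟩
      obtain ⟨i, hi⟩ := h'.mem_afv hfresh hx hxg
      exact hn i (by rw [afv_abstr]; exact ⟨hi, hne⟩)
    | spine => cases ha
    | flex => cases ha
  | spine hr _ ih =>
    cases h' with
    | lam => cases ha
    | spine _ h' => exact ih h' hF ha
    | flex _ _ hr' => exact absurd (hF ▸ hr) hr'
  | @flex b t F π es _ _ hr hπ hFπ hes =>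
    subst hF
    cases h' with
    | lam => cases ha
    | spine hr' => exact absurd hr' hr
    | @flex _ _ _ π' es' _ _ _ hπ' hFπ' hes' =>
      cases ha
      -- The permutations themselves may differ, but they agree on every variable that occurs in
      -- some member of the representative.
      have e : (support vs (rep V F)).map π = (support vs (rep V F)).map π' := by
        refine List.map_congr_left fun x hx => ?_
        obtain ⟨-, i, hi⟩ := mem_support.1 hx
        exact eq_of_perm_eq ((congrFun hFπ i).symm.trans (congrFun hFπ' i)) hi
      rw [← e] at hes'
      rw [toATm_apps, toATm_apps, map_toATm_eq_of_isEta hes hes']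
  | const c =>
    cases h' with
    | const c' => exact congrFun hF i₀
    | var => cases congrFun hF i₀
    | app => cases congrFun hF i₀
  | var =>
    cases h' with
    | const c' => cases congrFun hF i₀
    | var => exact congrFun hF i₀
    | app => cases congrFun hF i₀
  | app h₁ h₂ ih₁ ih₂ =>
    cases h' with
    | const c' => cases congrFun hF i₀
    | var => cases congrFun hF i₀
    | app h₁' h₂' =>
      have hF' := fun i => ATm.app.inj (congrFun hF i)
      have e₁ := funext fun i => (hF' i).1
      have e₂ := funext fun i => (hF' i).2
      simp only [toATm]
      rw [ih₁ h₁' e₁ ((h₁.hasType i₀).unique (e₁ ▸ h₁'.hasType i₀)),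
        ih₂ h₂' e₂ ((h₂.hasType i₀).unique (e₂ ▸ h₂'.hasType i₀))]

end Gen

end HOPattern

-- Existence of generalizations and their two universal properties.

namespace HOPattern

open Tm ATm

variable {N B C : Type*}

theorem forall₂_and {α β : Type*} {R S : α → β → Prop} {l : List α} {l' : List β}
    (h : List.Forall₂ R l l') (h' : List.Forall₂ S l l') :
    List.Forall₂ (fun x y => R x y ∧ S x y) l l' := by
  induction h with
  | nil => exact .nil
  | cons h _ ih => cases h' with
    | cons h₁ h₂ => exact .cons ⟨h, h₁⟩ (ih h₂)

/-- A map into an infinite type that is injective on a finite set and avoids a finite set. -/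
theorem exists_injOn_notMem [Infinite N] {α : Type*} {A : Set α} (hA : A.Finite) {E : Set N}
    (hE : E.Finite) : ∃ ν : α → N, A.InjOn ν ∧ ∀ a, ν a ∉ E := by
  have := hE.infinite_compl.to_subtype
  have := hA.to_subtype
  have e := Infinite.natEmbedding (Eᶜ : Set N)
  obtain ⟨n, ⟨f⟩⟩ := Finite.exists_equiv_fin A
  classical
  refine ⟨fun a => if h : a ∈ A then e (f ⟨a, h⟩) else e 0, fun a ha b hb hab => ?_, fun a => ?_⟩
  · simp only [ha, hb, dif_pos] at hab
    have := f.injective (Fin.ext (e.injective (Subtype.ext hab)))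
    exact congrArg Subtype.val this
  · dsimp only
    split
    · exact (e (f ⟨a, _⟩)).2
    · exact (e 0).2

theorem ClosedSubst.fsubst_lam {ct : C → Ty B} {V Q : Set (Var N B)} (S : ClosedSubst ct V Q)
    {x : Var N B} (hx : x ∈ V) {t : ATm N B C} (ht : t.afv ⊆ V ∪ Q) :
    fsubst S.val (.lam x.type (abstr x 0 t)) = .lam x.type (abstr x 0 (fsubst S.val t)) := by
  simp only [fsubst]
  rw [fsubst_abstr_self 0 _ (S.fix x hx)]
  intro z hz hzx hxz
  rcases ht hz with hzV | hzQ
  · rw [S.fix z hzV] at hxz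
    exact hzx (show x = z from hxz).symm
  · exact S.fresh z hzQ x hxz hx

theorem ClosedSubst.map_fsubst [Infinite N] {ct : C → Ty B} {V Q : Set (Var N B)}
    (S : ClosedSubst ct V Q) {ts : List (Tm N B C)} {xs : List (Var N B)}
    (h : List.Forall₂ (IsEta ct V) ts xs) (hx : ∀ x ∈ xs, x ∈ V) :
    (ts.map toATm).map (fsubst S.val) = ts.map toATm := by
  rw [List.map_map]
  refine List.map_congr_left fun t ht => fsubst_eq_self fun y hy => ?_
  obtain ⟨x, hxx, he⟩ := forall₂_mem_left h ht
  rw [afv_toATm] at hy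
  obtain rfl := he.mem_fv hy
  exact S.fix y (hx y hxx)

/-- Applying an abstraction to eta-long forms of renamed binders just renames its body. As `xs`
contains all free variables of the body that lie in `V`, the values of `π` elsewhere on `V` do not
matter. -/
theorem conv_apps_lams_perm [Infinite N] {ct : C → Ty B} {V : Set (Var N B)} {t : ATm N B C}
    {a : Ty B} (ht : ATm.HasType ct [] t a) {xs : List (Var N B)} (hxs : xs.Nodup)
    {π : Equiv.Perm (Var N B)} (hπ : π ∈ varPerm V) {us : List (Tm N B C)}
    (hus : List.Forall₂ (IsEta ct V) us (xs.map π)) (hV : ∀ z ∈ t.afv, z ∈ V → z ∈ xs) :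
    Conv ct [] a (ATm.apps (ATm.lams xs t) (us.map toATm)) (ATm.perm π t) := by
  rw [List.forall₂_map_right_iff] at hus
  obtain ⟨s', -, hs, hs', hc⟩ := Conv.apps_fsubst_lams (us := us.map toATm) ht hxs
    (by
      rw [List.forall₂_map_left_iff]
      exact hus.imp fun u x h => by
        have := h.1.hasType.toATm
        rwa [varPerm.type_eq hπ] at this)
    (s := .fvar) fun x => .fvar x
  rw [fsubst_fvar] at hc
  refine hc.trans (Conv.fsubst_congr ht fun z hz => ?_)
  by_cases hzx : z ∈ xs
  · rw [List.forall₂_map_left_iff] at hs'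
    obtain ⟨u, -, hu, he⟩ := forall₂_mem_right (forall₂_and hs' hus) hzx
    rw [hu, ← varPerm.type_eq hπ]
    exact he.2.2
  · rw [hs z hzx, hπ.2 z fun h => hzx (hV z hz h)]
    exact .refl (.fvar z)

section Gen

variable [Infinite N] {ct : C → Ty B} {V Q : Set (Var N B)} {I : Type*}
  {S : I → ClosedSubst ct V Q} {vs : List (Var N B)} {ν : (I → ATm N B C) × B → N}

/-- Arguments of a rigid spine have strictly smaller values than the spine. The bound `m` is kept
apart from the term so that the lemma also serves a rigid pattern that merely shares its values with
a flexible one. -/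
theorem exists_gen_spine (i₀ : I) {m : ℕ}
    (ih : ∀ u a, Pat ct V Q false u a → (values S false u i₀).size < m →
      ∃ g, Gen S vs ν false a (values S false u) g)
    {t : Tm N B C} {a : Ty B} (ht : Pat ct V Q true t a) (hm : (values S true t i₀).size ≤ m) :
    ∃ g, Gen S vs ν true a (values S true t) g := by
  generalize hβ : true = β at ht
  induction ht with
  | lam | flex | rigid => cases hβ
  | const c => exact ⟨_, .const c⟩
  | var hx => exact ⟨_, .var hx⟩
  | @app t u a b _ h₂ ih₁ _ =>
    have e : values S true (.app t u) =
        fun i => .app (values S true t i) (values S false u i) :=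
      funext fun i => by simp only [values, value]
    rw [e] at hm ⊢
    simp only [size] at hm
    obtain ⟨g, hg⟩ := ih₁ (by omega) rfl
    obtain ⟨g', hg'⟩ := ih u a h₂ (by omega)
    exact ⟨_, .app hg hg'⟩

/-- Every pattern has a least general generalization of the family of its values. -/
theorem exists_gen [Nonempty I] (hQ : Disjoint Q V) (hvs : ∀ x ∈ vs, x ∈ V) {t : Tm N B C} {a : Ty B}
    (ht : Pat ct V Q false t a) : ∃ g, Gen S vs ν false a (values S false t) g := by
  obtain ⟨i₀⟩ := ‹Nonempty I›
  -- The measure is the size of a value rather than of the pattern: a flexible pattern may be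
  -- replaced by a larger rigid one with the same values.
  induction hm : (values S false t i₀).size using Nat.strong_induction_on generalizing t a with
  | _ m ih =>
    have ih' : ∀ u a, Pat ct V Q false u a → (values S false u i₀).size < m →
      ∃ g, Gen S vs ν false a (values S false u) g := fun u a hu hlt => ih _ hlt hu rfl
    cases ht with
    | @lam x t b hx h =>
      have e : values S false (.lam x t) =
          fun i => .lam x.type (abstr x 0 (values S false t i)) :=
        funext fun i => Pat.value_lam (S i) hx h
      rw [e] at hm ⊢
      simp only [size, size_abstr] at hm
      obtain ⟨g, hg⟩ := ih' t b h (by omega)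
      exact ⟨_, .lam hx hg⟩
    | @flex t b h =>
      by_cases hr : IsRigid S (values S false t)
      · obtain ⟨t', b', ht', e⟩ := id hr
        have hb : ATm.HasType ct [] (values S false t i₀) (.base b') := by
          rw [e]; exact ht'.hasType_value (S i₀)
        have hbb := hb.unique ((Pat.flex h).hasType_value (S i₀))
        obtain ⟨g, hg⟩ := exists_gen_spine i₀ ih' ht' (by rw [← e]; exact hm.le)
        rw [← e, hbb] at hg
        exact ⟨g, .spine hr hg⟩
      · obtain ⟨π, hπ, hF⟩ := exists_eq_perm_rep (V := V) (values S false t)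
        -- Each variable of `V` occurring in a value is an argument of the flexible pattern, so an
        -- eta-long form of it with binders in `V` is already present among `ts`. This is why no new
        -- bound variable is needed.
        obtain ⟨es, hes⟩ := exists_forall₂ (R := IsEta ct V)
          (l := (support vs (rep V (values S false t))).map π) fun y hy => by
            obtain ⟨x, hx, rfl⟩ := List.mem_map.1 hy
            obtain ⟨hx, i, hi⟩ := mem_support.1 hx
            have hπx : π x ∈ (values S false t i).afv := by
              rw [hF]; exact mem_afv_perm.2 ⟨x, hi, rfl⟩
            have hπV := varPerm.apply_mem hπ (hvs x hx)
            have := (Pat.flex h).mem_afv_value (S i) hπV hπx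
            obtain ⟨X, xs, ts, hX, rfl⟩ := h
            rcases mem_fv_apps.1 this with hX' | ⟨e, he, hxe⟩
            · rw [show π x = X from hX'] at hπV
              exact absurd hπV (Set.disjoint_left.1 hQ hX.head_mem)
            · obtain ⟨y, -, hy⟩ := forall₂_mem_left hX.isEta he
              rw [hy.mem_fv hxe]
              exact ⟨e, hy⟩
        exact ⟨_, .flex h rfl hr hπ hF hes⟩
    | rigid h =>
      have e : values S false t = values S true t := funext fun i => h.value_eq (S i)
      obtain ⟨g, hg⟩ := exists_gen_spine i₀ ih' h (by rw [← e]; exact hm.le)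
      rw [← e] at hg
      exact ⟨g, .spine ⟨t, _, h, e⟩ hg⟩

/-- Two occurrences of the same variable in patterns differ by a permutation. -/
theorem exists_perm_of_flexAt (hQ : Disjoint Q V) {X : Var N B} {xs ys : List (Var N B)}
    {ts us : List (Tm N B C)} {b b' : B} (h : FlexAt ct V Q X xs ts b)
    (h' : FlexAt ct V Q X ys us b') : b = b' ∧ ∃ π ∈ varPerm V, ys = xs.map π ∧
      ∀ S : ClosedSubst ct V Q, value ct S.val false (Tm.apps (.var X) us) =
        ATm.perm π (value ct S.val false (Tm.apps (.var X) ts)) := by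
  obtain ⟨hl, hb⟩ := Ty.arrs_base_inj (h.type_eq.symm.trans h'.type_eq)
  obtain ⟨π, hπ, rfl⟩ := varPerm.exists_map_eq h.nodup h'.nodup h.mem h'.mem hl
  refine ⟨hb, π, hπ, rfl, fun S => ?_⟩
  rw [← Pat.value_perm S hQ hπ (.flex ⟨X, xs, ts, h, rfl⟩), perm_apps, Tm.perm,
    perm_var_of_mem hQ hπ h.head_mem, value_false, value_false, toATm_apps, toATm_apps,
    map_toATm_eq_of_isEta h'.isEta (forall₂_isEta_perm hπ h.isEta)]

/-- All occurrences of a given `X` have the same family up to a permutation, so each variable of `Q`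
contributes at most one class. -/
theorem flexClasses_finite (hQ : Disjoint Q V) (hfin : Q.Finite) : (flexClasses S).Finite := by
  have key : ∀ X : Var N B, {p : (I → ATm N B C) × B | ∃ xs ts b, FlexAt ct V Q X xs ts b ∧
      p = (rep V (values S false (Tm.apps (.var X) ts)), b)}.Subsingleton := by
    rintro X _ ⟨xs, ts, b, h, rfl⟩ _ ⟨ys, us, b', h', rfl⟩
    obtain ⟨rfl, π, hπ, -, hv⟩ := exists_perm_of_flexAt hQ h h'
    have e : values S false (Tm.apps (.var X) us) =
        fun i => ATm.perm π (values S false (Tm.apps (.var X) ts) i) := funext fun i => hv (S i)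
    rw [e, rep_perm hπ]
  refine (hfin.biUnion fun X _ => (key X).finite).subset ?_
  rintro ⟨F, b⟩ ⟨t, ⟨X, xs, ts, h, rfl⟩, rfl⟩
  exact Set.mem_biUnion h.head_mem ⟨xs, ts, b, h, rfl⟩

theorem hasType_of_mem_flexClasses {p : (I → ATm N B C) × B} (hp : p ∈ flexClasses S) (i : I) :
    ATm.HasType ct [] (p.1 i) (.base p.2) := by
  obtain ⟨t, ht, hF⟩ := hp
  obtain ⟨π, hπ, h⟩ := exists_eq_perm_rep (V := V) (values S false t)
  have := ((Pat.flex ht).hasType_value (S i)).perm (inv_mem hπ)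
  rw [show value ct (S i).val false t = _ from congrFun h i, ← ATm.perm_mul, inv_mul_cancel,
    ATm.perm_one, ← hF] at this
  exact this

open Classical in
/-- The substitution that recovers the `i`-th members of the families from their
generalizations. -/
noncomputable def instantiation (S : I → ClosedSubst ct V Q) {vs : List (Var N B)}
    {ν : (I → ATm N B C) × B → N} (hvs : ∀ x, x ∈ vs ↔ x ∈ V)
    (hfresh : ∀ p, ∀ x ∈ V, x.name ≠ ν p) (i : I) : ClosedSubst ct V Vᶜ where
  val z := if h : ∃ p ∈ flexClasses S, z = freshVar vs ν p then
    ATm.lams (support vs h.choose.1) (h.choose.1 i) else .fvar z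
  typed z := by
    split
    · rename_i h
      obtain ⟨hp, hz⟩ := h.choose_spec
      rw [congrArg Var.type hz]
      exact (hasType_of_mem_flexClasses hp i).lams _
    · exact .fvar z
  fix x hx := by
    rw [dif_neg]
    rintro ⟨p, -, rfl⟩
    exact hfresh p _ hx rfl
  fresh z hz y hy := by
    split at hy
    · rename_i h
      obtain ⟨hy, hy'⟩ := mem_afv_lams.1 hy
      -- Every variable of `V` in the member belongs to the support and has been abstracted.
      exact fun hV => hy' (mem_support.2 ⟨(hvs y).2 hV, i, hy⟩)
    · exact (show y = z from hy) ▸ hz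

theorem instantiation_freshVar (hvs : ∀ x, x ∈ vs ↔ x ∈ V)
    (hfresh : ∀ p, ∀ x ∈ V, x.name ≠ ν p) (hinj : (flexClasses S).InjOn ν) (i : I)
    {p : (I → ATm N B C) × B} (hp : p ∈ flexClasses S) :
    (instantiation S hvs hfresh i).val (freshVar vs ν p) =
      ATm.lams (support vs p.1) (p.1 i) := by
  have h : ∃ q ∈ flexClasses S, freshVar vs ν p = freshVar vs ν q := ⟨p, hp, rfl⟩
  simp only [instantiation]
  rw [dif_pos h]
  have e : p = h.choose := hinj hp h.choose_spec.1 (congrArg Var.name h.choose_spec.2)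
  rw [← e]

/-- Rigid parts are reproduced verbatim; at a leaf, beta reduction turns the abstracted
representative into its image under `π`, which is the actual member. -/
theorem Gen.conv_instantiation (hvs : ∀ x, x ∈ vs ↔ x ∈ V) (hnd : vs.Nodup)
    (hfresh : ∀ p, ∀ x ∈ V, x.name ≠ ν p) (hinj : (flexClasses S).InjOn ν) (i : I) {β : Bool}
    {a : Ty B} {F : I → ATm N B C} {g : Tm N B C} (h : Gen S vs ν β a F g) :
    Conv ct [] a (fsubst (instantiation S hvs hfresh i).val g.toATm) (F i) := by
  induction h with
  | lam hx _ ih =>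
    rw [toATm, ClosedSubst.fsubst_lam _ hx (by simp)]
    exact ih.lam_abstr _
  | spine _ _ ih => exact ih
  | @flex b t F π es h hF _ hπ hFπ hes =>
    have hmem : ∀ x ∈ (support vs (rep V F)).map π, x ∈ V := fun y hy => by
      obtain ⟨x, hx, rfl⟩ := List.mem_map.1 hy
      exact varPerm.apply_mem hπ ((hvs x).1 (mem_support.1 hx).1)
    have hp : (rep V F, b) ∈ flexClasses S := ⟨t, h, by rw [hF]⟩
    rw [toATm_apps, fsubst_apps, ClosedSubst.map_fsubst _ hes hmem, toATm, fsubst,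
      instantiation_freshVar hvs hfresh hinj i hp, congrFun hFπ i]
    exact conv_apps_lams_perm (hasType_of_mem_flexClasses hp i) (hnd.filter _) hπ hes
      fun z hz hzV => mem_support.2 ⟨(hvs z).2 hzV, i, hz⟩
  | const c => exact .refl (.const c)
  | @var x hx =>
    simp only [toATm, fsubst]
    rw [(instantiation S hvs hfresh i).fix x hx]
    exact .refl (.fvar x)
  | app _ _ ih₁ ih₂ => exact .app ih₁ ih₂

/-- `n` is an abstracted generalization of the values of an occurrence of `X`. -/
def IsGenOf (S : I → ClosedSubst ct V Q) (vs : List (Var N B)) (ν : (I → ATm N B C) × B → N)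
    (X : Var N B) (n : Tm N B C) : Prop :=
  ∃ xs ts b g, FlexAt ct V Q X xs ts b ∧
    Gen S vs ν false (.base b) (values S false (Tm.apps (.var X) ts)) g ∧ n = Tm.lams xs g

/-- A variable of `V` in the generalization occurs in some value, hence in the pattern itself, where
it can only be an argument. Abstracting over `xs` therefore leaves fresh variables only. -/
theorem Gen.mem_of_mem_fv [Nonempty I] (hQ : Disjoint Q V)
    (hfresh : ∀ p, ∀ x ∈ V, x.name ≠ ν p) {X : Var N B}
    {xs : List (Var N B)} {ts : List (Tm N B C)} {b : B} {g : Tm N B C}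
    (h : FlexAt ct V Q X xs ts b)
    (hg : Gen S vs ν false (.base b) (values S false (Tm.apps (.var X) ts)) g) {z : Var N B}
    (hz : z ∈ g.fv) (hzV : z ∈ V) : z ∈ xs := by
  obtain ⟨i, hi⟩ := hg.mem_afv hfresh hzV hz
  refine (h.mem_fv ((Pat.flex ⟨X, xs, ts, h, rfl⟩).mem_afv_value (S i) hzV hi)).resolve_left ?_
  rintro rfl
  exact Set.disjoint_left.1 hQ h.head_mem hzV

theorem IsGenOf.fv_subset [Nonempty I] (hQ : Disjoint Q V) (hvs : ∀ x, x ∈ vs ↔ x ∈ V)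
    (hfresh : ∀ p, ∀ x ∈ V, x.name ≠ ν p) {X : Var N B} {n : Tm N B C}
    (h : IsGenOf S vs ν X n) : n.fv ⊆ freshVar vs ν '' flexClasses S := by
  obtain ⟨xs, ts, b, g, hX, hg, rfl⟩ := h
  intro z hz
  rw [← afv_toATm, toATm_lams, mem_afv_lams, afv_toATm] at hz
  refine (hg.fv_subset (fun x => (hvs x).1) hz.1).resolve_left fun hzV => ?_
  exact hz.2 (hg.mem_of_mem_fv hQ hfresh hX hz.1 hzV)

theorem IsGenOf.long {X : Var N B} {n : Tm N B C} (h : IsGenOf S vs ν X n) :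
    Long ct n X.type := by
  obtain ⟨xs, ts, b, g, hX, hg, rfl⟩ := h
  rw [hX.type_eq]
  exact hg.long.lams xs

theorem IsGenOf.bv_subset {X : Var N B} {n : Tm N B C} (h : IsGenOf S vs ν X n) : n.bv ⊆ V := by
  obtain ⟨xs, ts, b, g, hX, hg, rfl⟩ := h
  intro y hy
  exact (mem_bv_lams.1 hy).elim (hX.mem y) (hg.bv_subset ·)

/-- The substitution by the generalizations solves the problem on the level of families. -/
theorem Tm.Pat.exists_gen_conv [Nonempty I] (hQ : Disjoint Q V)
    (hfresh : ∀ p, ∀ x ∈ V, x.name ≠ ν p) (M : ClosedSubst ct V Q)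
    (hM : ∀ X ∈ Q, ∃ n, IsGenOf S vs ν X n ∧ M.val X = n.toATm) {β : Bool}
    {t : Tm N B C} {a : Ty B} (ht : Pat ct V Q β t a) :
    ∃ g, Gen S vs ν β a (values S β t) g ∧ Conv ct [] a (fsubst M.val t.toATm) g.toATm := by
  induction ht with
  | @lam x t b hx h ih =>
    obtain ⟨g, hg, hc⟩ := ih
    have e : values S false (.lam x t) =
        fun i => .lam x.type (abstr x 0 (values S false t i)) :=
      funext fun i => Pat.value_lam (S i) hx h
    refine ⟨.lam x g, e ▸ .lam hx hg, ?_⟩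
    rw [toATm, M.fsubst_lam hx (by rw [afv_toATm]; exact h.fv_subset)]
    exact hc.lam_abstr x
  | @flex t b h =>
    obtain ⟨X, ys, us, h, rfl⟩ := h
    obtain ⟨_, ⟨xs, ts, b', g, hX, hg, rfl⟩, hMX⟩ := hM X h.head_mem
    -- The given occurrence of `X` differs by `π` from the one used to define the image of `X`; by
    -- equivariance `g.perm π` generalizes its family, and beta reduction produces exactly that
    -- term.
    obtain ⟨rfl, π, hπ, rfl, hv⟩ := exists_perm_of_flexAt hQ hX h
    have e : values S false (Tm.apps (.var X) us) =
        fun i => ATm.perm π (values S false (Tm.apps (.var X) ts) i) := funext fun i => hv (S i)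
    refine ⟨g.perm π, e ▸ hg.perm hQ hπ hfresh, ?_⟩
    rw [toATm_apps, fsubst_apps, M.map_fsubst h.isEta h.mem, toATm, fsubst, hMX, toATm_lams,
      toATm_perm hπ]
    refine conv_apps_lams_perm hg.hasType_right.toATm hX.nodup hπ h.isEta fun z hz hzV => ?_
    rw [afv_toATm] at hz
    exact hg.mem_of_mem_fv hQ hfresh hX hz hzV
  | @rigid t b h ih =>
    obtain ⟨g, hg, hc⟩ := ih
    have e : values S false t = values S true t := funext fun i => h.value_eq (S i)
    rw [e]
    exact ⟨g, .spine ⟨t, _, h, rfl⟩ hg, hc⟩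
  | const c => exact ⟨.const c, .const c, .refl (.const c)⟩
  | @var x hx =>
    refine ⟨.var x, .var hx, ?_⟩
    simp only [toATm, fsubst]
    rw [M.fix x hx]
    exact .refl (.fvar x)
  | @app t u a b _ _ ih₁ ih₂ =>
    obtain ⟨g, hg, hc⟩ := ih₁
    obtain ⟨g', hg', hc'⟩ := ih₂
    have e : values S true (.app t u) =
        fun i => .app (values S true t i) (values S false u i) :=
      funext fun i => by simp only [values, value]
    exact ⟨.app g g', e ▸ .app hg hg', hc.app hc'⟩

/-- The substitution by the generalizations is at least as general as every member. -/
theorem IsGenOf.conv_instantiation [Nonempty I] (hQ : Disjoint Q V)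
    (hvs : ∀ x, x ∈ vs ↔ x ∈ V) (hnd : vs.Nodup)
    (hfresh : ∀ p, ∀ x ∈ V, x.name ≠ ν p) (hinj : (flexClasses S).InjOn ν) (i : I)
    {X : Var N B} {n : Tm N B C} (h : IsGenOf S vs ν X n) :
    Conv ct [] X.type (fsubst (instantiation S hvs hfresh i).val n.toATm) ((S i).val X) := by
  obtain ⟨xs, ts, b, g, hX, hg, rfl⟩ := h
  have hp : Pat ct V Q false (Tm.apps (.var X) ts) (.base b) := .flex ⟨X, xs, ts, hX, rfl⟩
  have hT := (S i).typed X
  rw [toATm_lams, fsubst_lams (fun x hx => ClosedSubst.fix _ x (hX.mem x hx))]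
  · rw [hX.type_eq] at hT ⊢
    -- Under the abstraction over `xs`, the instance becomes the value, then the unnormalized
    -- application of `(S i).val X`; eta contraction finally removes `xs`.
    refine .trans ((hg.conv_instantiation hvs hnd hfresh hinj i).lams xs) ?_
    refine .trans ((hp.conv_value (S i)).symm.lams xs) ?_
    refine .trans (Conv.lams xs ?_) (Conv.lams_apps hT hX.nodup
      fun x hx hx' => (S i).fresh X hX.head_mem x hx' (hX.mem x hx))
    rw [toATm_apps, fsubst_apps, (S i).map_fsubst hX.isEta hX.mem]
    refine .apps (.refl hT) ?_ (by simpa using hX.isEta.length_eq)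
    have := hX.isEta
    clear * - this
    induction this with
    | nil => exact .nil
    | cons h _ ih => exact .cons h.2.2 ih
  · intro z hz hzx x hx hxz
    rw [afv_toATm] at hz
    by_cases hzV : z ∈ V
    · exact hzx (hg.mem_of_mem_fv hQ hfresh hX hz hzV)
    · exact ClosedSubst.fresh _ z hzV x hxz (hX.mem x hx)

end Gen

end HOPattern

-- From arbitrary unifiers to the index set, and the most general unifier.

namespace HOPattern

open Tm ATm

variable {N B C : Type*}

namespace Problem

theorem vars_finite (P : Problem N B C) : P.vars.Finite := by
  have : P.vars = ⋃ e ∈ (P : Set (Tm N B C × Tm N B C)), (e.1.fv ∪ e.2.fv) := by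
    ext x; simp [vars]
  rw [this]
  exact P.finite_toSet.biUnion fun e _ => e.1.fv_finite.union e.2.fv_finite

theorem boundVars_finite (P : Problem N B C) : P.boundVars.Finite := by
  have : P.boundVars = ⋃ e ∈ (P : Set (Tm N B C × Tm N B C)), (e.1.bv ∪ e.2.bv) := by
    ext x; simp [boundVars]
  rw [this]
  exact P.finite_toSet.biUnion fun e _ => e.1.bv_finite.union e.2.bv_finite

end Problem

theorem Subst.hasType_image {ct : C → Ty B} (σ : Subst N B ct) (X : Var N B) :
    ATm.HasType ct [] (σ.image X) X.type := by
  unfold Subst.image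
  split
  · rename_i h; exact (σ.typed X h).toATm
  · exact .fvar X

open Classical in
/-- Renaming the variables of `V` by means of `ν`. -/
noncomputable def renameAway (C : Type*) (V : Set (Var N B)) (ν : Var N B → N) (x : Var N B) :
    ATm N B C := if x ∈ V then .fvar ⟨ν x, x.type⟩ else .fvar x

open Classical in
/-- The inverse of `renameAway`. -/
noncomputable def renameBack (C : Type*) (V : Set (Var N B)) (ν : Var N B → N) (z : Var N B) :
    ATm N B C := if h : ∃ x ∈ V, z = ⟨ν x, x.type⟩ then .fvar h.choose else .fvar z

section Rename

variable {V : Set (Var N B)} {ν : Var N B → N} {ct : C → Ty B}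

theorem hasType_renameAway (x : Var N B) : ATm.HasType ct [] (renameAway C V ν x) x.type := by
  unfold renameAway; split
  · exact .fvar (⟨ν x, x.type⟩ : Var N B)
  · exact .fvar x

theorem hasType_renameBack (z : Var N B) : ATm.HasType ct [] (renameBack C V ν z) z.type := by
  unfold renameBack; split
  · rename_i h
    rw [congrArg Var.type h.choose_spec.2]
    exact .fvar h.choose
  · exact .fvar z

theorem fsubst_renameBack_renameAway (hν : V.InjOn ν) {t : ATm N B C}
    (ht : ∀ z ∈ t.afv, ∀ x, z.name ≠ ν x) :
    fsubst (renameBack C V ν) (fsubst (renameAway C V ν) t) = t := by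
  rw [fsubst_fsubst]
  refine fsubst_eq_self fun x hx => ?_
  unfold renameAway
  split
  · rename_i hxV
    have h : ∃ y ∈ V, (⟨ν x, x.type⟩ : Var N B) = ⟨ν y, y.type⟩ := ⟨x, hxV, rfl⟩
    simp only [fsubst, renameBack]
    rw [dif_pos h]
    rw [← hν hxV h.choose_spec.1 (congrArg Var.name h.choose_spec.2)]
  · simp only [fsubst, renameBack]
    rw [dif_neg]
    rintro ⟨y, -, rfl⟩
    exact ht _ hx y rfl

open Classical in
/-- The substitution `τ`, made to avoid the variables of `V`. -/
noncomputable def Subst.away (τ : Subst N B ct) {Q : Set (Var N B)} (hQ : Disjoint Q V)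
    (hν : ∀ x, ∀ y ∈ V, y.name ≠ ν x) : ClosedSubst ct V Q where
  val X := if X ∈ V then .fvar X else fsubst (renameAway C V ν) (τ.image X)
  typed X := by
    split
    · exact .fvar X
    · exact (τ.hasType_image X).fsubst hasType_renameAway
  fix x hx := if_pos hx
  fresh X hX y hy := by
    rw [if_neg (Set.disjoint_left.1 hQ hX)] at hy
    obtain ⟨x, -, hxy⟩ := mem_afv_fsubst.1 hy
    unfold renameAway at hxy
    split at hxy
    · exact fun hV => hν x y hV (by rw [show y = _ from hxy])
    · exact (show y = x from hxy) ▸ ‹_›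

end Rename

/-- Up to a renaming `d`, a unifier does not introduce bound variables of the problem. -/
theorem Subst.IsUnifier.exists_closedSubst [Infinite N] {ct : C → Ty B} {P : Problem N B C}
    (hQ : Disjoint P.vars P.boundVars) {τ : Subst N B ct} (hτ : τ.IsUnifier P) :
    ∃ i : ClosedSubst ct P.boundVars P.vars,
      (∀ e ∈ P, ∃ a, Conv ct [] a (fsubst i.val e.1.toATm) (fsubst i.val e.2.toATm)) ∧
      ∃ d : Var N B → ATm N B C, (∀ z, ATm.HasType ct [] (d z) z.type) ∧
        ∀ X ∈ P.vars, fsubst d (i.val X) = τ.image X := by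
  -- The new names avoid all names free in the images under `τ` and all bound names, so the renaming
  -- is invertible on those images and leads out of `V`.
  obtain ⟨ν, hinj, hν⟩ := exists_injOn_notMem P.boundVars_finite
    (((P.vars_finite.biUnion fun X _ => (τ.image X).afv_finite).union
      P.boundVars_finite).image Var.name)
  have hν' : ∀ x, ∀ y ∈ P.boundVars, y.name ≠ ν x := fun x y hy e => hν x ⟨y, Or.inr hy, e⟩
  have hval : ∀ X ∈ P.vars, (τ.away hQ hν').val X =
      fsubst (renameAway C P.boundVars ν) (τ.image X) := fun X hX =>
    if_neg (Set.disjoint_left.1 hQ hX)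
  have htm : ∀ t : Tm N B C, t.fv ⊆ P.vars → fsubst (τ.away hQ hν').val t.toATm =
      fsubst (renameAway C P.boundVars ν) (τ.apply t.toATm) := fun t ht => by
    rw [Subst.apply, fsubst_fsubst]
    exact fsubst_congr fun x hx => hval x (ht (by rwa [afv_toATm] at hx))
  refine ⟨τ.away hQ hν', fun e he => ?_, renameBack C P.boundVars ν, hasType_renameBack,
    fun X hX => ?_⟩
  · rw [htm _ fun x hx => ⟨e, he, Or.inl hx⟩, htm _ fun x hx => ⟨e, he, Or.inr hx⟩]
    obtain ⟨a, h⟩ := hτ e he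
    exact ⟨a, h.fsubst hasType_renameAway⟩
  · rw [hval X hX, fsubst_renameBack_renameAway hinj]
    exact fun z hz x hzx => hν x ⟨z, Or.inl (Set.mem_biUnion hX hz), hzx⟩

theorem Problem.IsPatternProblem.pat {ct : C → Ty B} {P : Problem N B C}
    (hpat : P.IsPatternProblem ct) {e : Tm N B C × Tm N B C} (he : e ∈ P) :
    ∃ a, Pat ct P.boundVars P.vars false e.1 a ∧ Pat ct P.boundVars P.vars false e.2 a := by
  obtain ⟨⟨a, h₁, h₂⟩, h₃, h₄⟩ := hpat e he
  exact ⟨a, h₃.pat h₁ (Set.empty_subset _) (fun x hx => ⟨e, he, Or.inl hx⟩)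
      fun x hx => Or.inr ⟨e, he, Or.inl hx⟩,
    h₄.pat h₂ (Set.empty_subset _) (fun x hx => ⟨e, he, Or.inr hx⟩)
      fun x hx => Or.inr ⟨e, he, Or.inr hx⟩⟩

theorem Subst.image_of_mem {ct : C → Ty B} {σ : Subst N B ct} {X : Var N B} (h : X ∈ σ.dom) :
    σ.image X = (σ.val X).toATm := by simp [Subst.image, h]

theorem Subst.image_of_notMem {ct : C → Ty B} {σ : Subst N B ct} {X : Var N B}
    (h : X ∉ σ.dom) : σ.image X = .fvar X := by simp [Subst.image, h]

/-- A solvable pattern unification problem has a most general unifier whose bound variables are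
among those of the problem and whose free variables take a sublist of any enumeration of these. -/
theorem Problem.IsPatternProblem.exists_isMostGeneral [Infinite N] {ct : C → Ty B}
    {P : Problem N B C} (hpat : P.IsPatternProblem ct)
    (hsolv : ∃ σ : Subst N B ct, σ.IsUnifier P) (hQ : Disjoint P.vars P.boundVars)
    {vs : List (Var N B)} (hnd : vs.Nodup) (hvs : ∀ x, x ∈ vs ↔ x ∈ P.boundVars) :
    ∃ σ : Subst N B ct, σ.IsMostGeneral P ∧ σ.IsLong ∧ σ.boundVars ⊆ P.boundVars ∧
      ∀ Z ∈ σ.freeVars, Z.type.args.Sublist (vs.map Var.type) := by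
  classical
  let I := {i : ClosedSubst ct P.boundVars P.vars // ∀ e ∈ P, ∃ a,
    Conv ct [] a (fsubst i.val e.1.toATm) (fsubst i.val e.2.toATm)}
  let S : I → ClosedSubst ct P.boundVars P.vars := Subtype.val
  have : Nonempty I := by
    obtain ⟨τ, hτ⟩ := hsolv
    obtain ⟨i, hi, -⟩ := hτ.exists_closedSubst hQ
    exact ⟨⟨i, hi⟩⟩
  have hfin : (flexClasses S).Finite := flexClasses_finite hQ P.vars_finite
  obtain ⟨ν, hinj, hν⟩ := exists_injOn_notMem hfin (P.boundVars_finite.image Var.name)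
  have hfresh : ∀ p, ∀ x ∈ P.boundVars, x.name ≠ ν p := fun p x hx e => hν p ⟨x, hx, e⟩
  have hgen : ∀ X, ∃ n, X ∈ P.vars → IsGenOf S vs ν X n := fun X => by
    by_cases hX : X ∈ P.vars
    · obtain ⟨xs, ts, b, h⟩ : ∃ xs ts b, FlexAt ct P.boundVars P.vars X xs ts b := by
        obtain ⟨e, he, h | h⟩ := id hX
        all_goals obtain ⟨a, h₁, h₂⟩ := hpat.pat he
        · exact h₁.exists_flexAt hQ hX h
        · exact h₂.exists_flexAt hQ hX h
      obtain ⟨g, hg⟩ := exists_gen (S := S) (ν := ν) hQ (fun x => (hvs x).1)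
        (Pat.flex ⟨X, xs, ts, h, rfl⟩)
      exact ⟨_, fun _ => ⟨xs, ts, b, g, h, hg, rfl⟩⟩
    -- A dummy value outside the domain of the substitution.
    · exact ⟨.var X, fun h => absurd h hX⟩
  choose val hval using hgen
  let σ : Subst N B ct := ⟨P.vars_finite.toFinset, val, fun X hX =>
    (hval X (P.vars_finite.mem_toFinset.1 hX)).long.hasType⟩
  have himg : ∀ X ∈ P.vars, σ.image X = (val X).toATm := fun X hX =>
    Subst.image_of_mem (P.vars_finite.mem_toFinset.2 hX)
  have hfv : ∀ X ∈ P.vars, (val X).fv ⊆ freshVar vs ν '' flexClasses S := fun X hX =>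
    (hval X hX).fv_subset hQ hvs hfresh
  let M : ClosedSubst ct P.boundVars P.vars :=
    { val := σ.image
      typed := σ.hasType_image
      fix := fun x hx => Subst.image_of_notMem fun h =>
        Set.disjoint_left.1 hQ (P.vars_finite.mem_toFinset.1 h) hx
      fresh := fun X hX y hy hyV => by
        rw [himg X hX, afv_toATm] at hy
        obtain ⟨p, -, rfl⟩ := hfv X hX hy
        exact hfresh p _ hyV rfl }
  have hM : ∀ X ∈ P.vars, ∃ n, IsGenOf S vs ν X n ∧ M.val X = n.toATm := fun X hX =>
    ⟨val X, hval X hX, himg X hX⟩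
  refine ⟨σ, ⟨fun e he => ?_, P.vars_finite.coe_toFinset, fun τ hτ => ?_⟩,
    fun X hX => (hval X (P.vars_finite.mem_toFinset.1 hX)).long, ?_, ?_⟩
  · obtain ⟨a, h₁, h₂⟩ := hpat.pat he
    obtain ⟨g₁, hg₁, hc₁⟩ := h₁.exists_gen_conv hQ hfresh M hM
    obtain ⟨g₂, hg₂, hc₂⟩ := h₂.exists_gen_conv hQ hfresh M hM
    -- Every index is a unifier, so the two sides have equal normal forms at each index and the same
    -- generalization.
    have e : values S false e.1 = values S false e.2 := funext fun i => by
      obtain ⟨b, hb⟩ := i.2 e he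
      simp only [values, value_false]
      exact nf_eq_of_conv hb
    rw [hg₁.toATm_eq hQ hfresh hg₂ e] at hc₁
    exact ⟨a, hc₁.trans hc₂.symm⟩
  · obtain ⟨i, hi, d, hd, hdi⟩ := hτ.exists_closedSubst hQ
    let R := instantiation S hvs hfresh ⟨i, hi⟩
    -- The mediating substitution is the instantiation at `i` followed by undoing the renaming `d`.
    -- The fresh variables of the finitely many classes suffice as its domain, since only they occur
    -- in the unifier.
    choose r hr hr' using fun z => exists_toATm_eq ((R.typed z).fsubst hd)
    refine ⟨⟨(hfin.image (freshVar vs ν)).toFinset, r, fun z _ => hr z⟩, fun X hX => ?_⟩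
    have h := ((hval X hX).conv_instantiation hQ hvs hnd hfresh hinj ⟨i, hi⟩).fsubst hd
    rw [show (S ⟨i, hi⟩).val X = i.val X from rfl, hdi X hX, fsubst_fsubst] at h
    rw [Subst.apply, himg X hX, fsubst_congr fun z hz => ?_]
    · exact h
    · rw [afv_toATm] at hz
      rw [Subst.image_of_mem ((hfin.image _).mem_toFinset.2 (hfv X hX hz))]
      exact hr' z
  · rintro y ⟨X, hX, hy⟩
    exact (hval X (P.vars_finite.mem_toFinset.1 hX)).bv_subset hy
  · rintro Z ⟨X, hX, hZ⟩
    obtain ⟨p, -, rfl⟩ := hfv X (P.vars_finite.mem_toFinset.1 hX) hZ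
    rw [freshVar, Ty.args_arrs]
    exact List.filter_sublist.map _

end HOPattern

theorem mainTheorem5 {N B C : Type*} [Infinite N] (ct : C → HOPattern.Ty B)
    (P : HOPattern.Problem N B C)
    (hpat : P.IsPatternProblem ct)
    (hsolv : ∃ σ : HOPattern.Subst N B ct, σ.IsUnifier P)
    (hdisj : Disjoint (HOPattern.Var.name '' P.vars) (HOPattern.Var.name '' P.boundVars))
    (as : List N) (hnodup : as.Nodup)
    (has : ∀ a : N, a ∈ as ↔ a ∈ HOPattern.Var.name '' P.boundVars) :
    ∃ σ : HOPattern.Subst N B ct, σ.IsMostGeneral P ∧ σ.IsLong ∧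
      (∀ x ∈ σ.boundVars, x.name ∈ as) ∧
      ∀ τ : N → HOPattern.Ty B, (∀ x ∈ P.boundVars, x.type = τ x.name) →
        (∀ x ∈ σ.boundVars, x.type = τ x.name) ∧
        (∀ Z ∈ σ.freeVars, Z.type.args.Sublist (as.map τ)) := by
  classical
  have hQ : Disjoint P.vars P.boundVars := hdisj.of_image
  -- The unifier must be fixed before the type assignment is given. If one exists, `as` itself
  -- enumerates the bound variables, and any other assignment agrees with it on `as`.
  by_cases h : ∃ τ₀ : N → HOPattern.Ty B, ∀ x ∈ P.boundVars, x.type = τ₀ x.name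
  · obtain ⟨τ₀, h₀⟩ := h
    obtain ⟨σ, h₁, h₂, h₃, h₄⟩ := hpat.exists_isMostGeneral hsolv hQ
      (vs := as.map fun a => ⟨a, τ₀ a⟩)
      (hnodup.map fun a b hab => congrArg HOPattern.Var.name hab) (fun x => by
        rw [List.mem_map]
        constructor
        · rintro ⟨a, ha, rfl⟩
          obtain ⟨x, hx, rfl⟩ := (has a).1 ha
          rwa [← h₀ x hx]
        · exact fun hx => ⟨x.name, (has _).2 ⟨x, hx, rfl⟩, by rw [← h₀ x hx]⟩)
    refine ⟨σ, h₁, h₂, fun x hx => (has _).2 ⟨x, h₃ hx, rfl⟩, fun τ hτ =>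
      ⟨fun x hx => hτ x (h₃ hx), fun Z hZ => ?_⟩⟩
    have := h₄ Z hZ
    rw [List.map_map] at this
    rwa [List.map_congr_left (f := τ) (g := HOPattern.Var.type ∘ fun a => ⟨a, τ₀ a⟩)]
    intro a ha
    obtain ⟨x, hx, rfl⟩ := (has a).1 ha
    exact (hτ x hx).symm.trans (h₀ x hx)
  -- Here some name carries two types, so the typed conclusions are vacuous and any enumeration will
  -- do.
  · obtain ⟨σ, h₁, h₂, h₃, -⟩ := hpat.exists_isMostGeneral hsolv hQ
      (vs := P.boundVars_finite.toFinset.toList) (Finset.nodup_toList _) (by simp)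
    exact ⟨σ, h₁, h₂, fun x hx => (has _).2 ⟨x, h₃ hx, rfl⟩, fun τ hτ => absurd ⟨τ, hτ⟩ h⟩
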